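/- **Theorem (Error bound of the statistical dimension in (ML1P)).** Let $n,l\in\mathbb{N}$, $\lambda\ge 0$ and $W\in\mathbb{R}^{n\times l}$. For a matrix $X\in\mathbb{R}^{n\times l}$ with rows $x^1,\dots,x^n$ put $\|X\|_{2,1}=\sum_{i=1}^n\|x^i\|_2$ and $$\zeta_W(X)=\|X\|_{2,1}+\lambda\|X-W\|_{2,1}.$$ Write $\langle X,Y\rangle=\operatorname{tr}(X^TY)$, let $\|\cdot\|_F$ be the Frobenius norm, and let $\partial\zeta_W(X)=\{S:\ \zeta_W(Y)\ge\zeta_W(X)+\langle S,Y-X\rangle\ \text{for all }Y\in\mathbb{R}^{n\times l}\}$ be the subdifferential. Let $\mathcal{D}(\zeta_W,X)=\bigcup_{\tau>0}\{U:\zeta_W(X+\tau U)\le\zeta_W(X)\}$ be the descent cone. Let $G\in\mathbb{R}^{n\times l}$ be a random matrix with independent standard normal entries. For a convex cone $\mathcal{C}\subset\mathbb{R}^{n\times l}$ let $\delta(\mathcal{C})=\mathbb{E}\big[\|\Pi(G,\overline{\mathcal{C}})\|_F^2\big]$ be its statistical dimension, where $\Pi(\cdot,\overline{\mathcal C})$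 is the Euclidean projection onto the closure of $\mathcal{C}$. Suppose that $\partial\zeta_W(X)$ is nonempty and compact and does not contain the origin. Put $$F(\tau)=\mathbb{E}\big[\operatorname{dist}^2(G,\tau\,\partial\zeta_W(X))\big]\quad(\tau\ge 0),\qquad m(X)=\inf_{S\in\partial\zeta_W(X)}\langle S,X\rangle .$$ 1. $\displaystyle\delta(\mathcal{D}(\zeta_W,X))\le\inf_{\tau\ge0}F(\tau)$. 2. If $m(X)>0$, then $$\inf_{\tau\ge0}F(\tau)-\xi(X)\le\delta(\mathcal{D}(\zeta_W,X)),\qquad \xi(X)=\frac{2\|X\|_F\cdot\sup\{\|S\|_F:S\in\partial\zeta_W(X)\}}{m(X)} .$$ 3. If $\lambda<1$, then $m(X)>0$, so that the bound in 2 holds. 4. If $\lambda<1$ and $X$ is $k$-joint sparse (exactly $k$ of its rows are nonzero), then $$\inf_{\tau\ge0}F(\tau)-\frac{2(1+\lambda)\sqrt n}{(1-\lambda)\sqrt k}\le\delta(\mathcal{D}(\zeta_W,X))\le\inf_{\tau\ge0}F(\tau).$$ -/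

import Mathlib

open MeasureTheory ProbabilityTheory
open scoped Pointwise RealInnerProductSpace

noncomputable section

/-- Real `n × l` matrices. The entry in row `i` and column `j` of `X` is `X i j`, and `X i` is the
`i`-th row with its Euclidean norm. The norm of `RealMat n l` is the Frobenius norm and its inner
product is `⟪X, Y⟫ = tr (Xᵀ Y)`; see `RealMat.norm_sq_eq` and `RealMat.inner_eq`. -/
abbrev RealMat (n l : ℕ) : Type := PiLp 2 (fun _ : Fin n => EuclideanSpace ℝ (Fin l))

theorem RealMat.norm_sq_eq {n l : ℕ} (X : RealMat n l) : ‖X‖ ^ 2 = ∑ i, ∑ j, X i j ^ 2 := by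
  simp [PiLp.norm_sq_eq_of_L2]

theorem RealMat.inner_eq {n l : ℕ} (X Y : RealMat n l) :
    ⟪X, Y⟫ = Matrix.trace ((Matrix.of fun i j => X i j).transpose * Matrix.of fun i j => Y i j) := by
  simp only [PiLp.inner_apply, Matrix.trace, Matrix.diag_apply, Matrix.mul_apply,
    Matrix.transpose_apply, Matrix.of_apply, RCLike.inner_apply, conj_trivial]
  rw [Finset.sum_comm]
  exact Finset.sum_congr rfl fun _ _ => Finset.sum_congr rfl fun _ _ => mul_comm _ _

/-- The `ℓ_{2,1}`-norm: the sum of the Euclidean norms of the rows. -/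
def norm21 {n l : ℕ} (X : RealMat n l) : ℝ := ∑ i, ‖X i‖

/-- The `ℓ_{2,1}`-norm with prior information `W` and weight `lam`. -/
def zeta {n l : ℕ} (lam : ℝ) (W X : RealMat n l) : ℝ := norm21 X + lam * norm21 (X - W)

/-- `X` is `k`-joint sparse: exactly `k` of its rows are nonzero. -/
def IsJointSparse {n l : ℕ} (k : ℕ) (X : RealMat n l) : Prop := {i | X i ≠ 0}.ncard = k

section General

variable {E : Type*} [NormedAddCommGroup E] [InnerProductSpace ℝ E]

/-- The subdifferential of a real-valued function at a point. -/
def subdiff (f : E → ℝ) (x : E) : Set E := {s | ∀ y, f x + ⟪s, y - x⟫ ≤ f y}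

/-- The descent cone of a real-valued function at a point. -/
def descentCone (f : E → ℝ) (x : E) : Set E := ⋃ t : Set.Ioi (0 : ℝ), {u | f (x + (t : ℝ) • u) ≤ f x}

open Classical in
/-- The Euclidean projection onto `K`: the point of `K` that is nearest to `x` (unique if `K` is
nonempty, closed and convex, see `proj_mem`, `norm_sub_proj_le`, `eq_proj`). The value is `0` if
there is no nearest point. -/
def proj (K : Set E) (x : E) : E :=
  if h : ∃ y ∈ K, ∀ z ∈ K, ‖x - y‖ ≤ ‖x - z‖ then h.choose else 0

theorem exists_nearest [FiniteDimensional ℝ E] {K : Set E} (hK : IsClosed K) (hne : K.Nonempty)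
    (x : E) : ∃ y ∈ K, ∀ z ∈ K, ‖x - y‖ ≤ ‖x - z‖ := by
  have : ProperSpace E := FiniteDimensional.proper ℝ E
  obtain ⟨y, hy, h⟩ := hK.exists_infDist_eq_dist hne x
  refine ⟨y, hy, fun z hz => ?_⟩
  rw [← dist_eq_norm, ← dist_eq_norm, ← h]
  exact Metric.infDist_le_dist_of_mem hz

theorem proj_mem [FiniteDimensional ℝ E] {K : Set E} (hK : IsClosed K) (hne : K.Nonempty)
    (x : E) : proj K x ∈ K := by
  rw [proj, dif_pos (exists_nearest hK hne x)]
  exact (exists_nearest hK hne x).choose_spec.1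

theorem norm_sub_proj_le [FiniteDimensional ℝ E] {K : Set E} (hK : IsClosed K) (hne : K.Nonempty)
    (x : E) : ∀ z ∈ K, ‖x - proj K x‖ ≤ ‖x - z‖ := by
  rw [proj, dif_pos (exists_nearest hK hne x)]
  exact (exists_nearest hK hne x).choose_spec.2

theorem eq_proj [FiniteDimensional ℝ E] {K : Set E} (hK : IsClosed K) (hc : Convex ℝ K)
    {x y : E} (hy : y ∈ K) (h : ∀ z ∈ K, ‖x - y‖ ≤ ‖x - z‖) : y = proj K x := by
  have hne : K.Nonempty := ⟨y, hy⟩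
  have hp := proj_mem hK hne x
  have e : ‖x - y‖ = ‖x - proj K x‖ := le_antisymm (h _ hp) (norm_sub_proj_le hK hne x y hy)
  have hm := h _ (hc hy hp (by norm_num : (0 : ℝ) ≤ 1 / 2) (by norm_num : (0 : ℝ) ≤ 1 / 2)
    (by norm_num))
  have par := parallelogram_law_with_norm ℝ (x - y) (x - proj K x)
  have e1 : (x - y) + (x - proj K x)
      = (2 : ℝ) • (x - ((1 / 2 : ℝ) • y + (1 / 2 : ℝ) • proj K x)) := by module
  rw [e1, norm_smul, ← e] at par
  norm_num at par hm
  have h0 : ‖proj K x - y‖ = 0 := by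
    have := norm_nonneg (x - y)
    nlinarith [norm_nonneg (proj K x - y)]
  exact (sub_eq_zero.1 (norm_eq_zero.1 h0)).symm

variable [FiniteDimensional ℝ E] [MeasurableSpace E] [BorelSpace E]

/-- The statistical dimension of a convex cone `C`: the expected squared norm of the projection of a
standard Gaussian vector onto `C`. As usual, a cone that is not closed has the statistical dimension
of its closure. -/
def statDim (C : Set E) : ℝ := ∫ g, ‖proj (closure C) g‖ ^ 2 ∂(stdGaussian E)

/-- `F(τ) = 𝔼 [dist² (G, τ K)]` for a standard Gaussian vector `G`. -/
def expSqDist (K : Set E) (τ : ℝ) : ℝ := ∫ g, Metric.infDist g (τ • K) ^ 2 ∂(stdGaussian E)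

end General

/-- The smallest value of `⟪S, X⟫` for `S ∈ ∂ζ_W(X)`. -/
def minPairing {n l : ℕ} (lam : ℝ) (W X : RealMat n l) : ℝ :=
  sInf ((fun S => ⟪S, X⟫) '' subdiff (zeta lam W) X)

/-- The error term `ξ(X)`. -/
def xi {n l : ℕ} (lam : ℝ) (W X : RealMat n l) : ℝ :=
  2 * ‖X‖ * sSup ((fun S => ‖S‖) '' subdiff (zeta lam W) X) / minPairing lam W X

end

/-! Both bounds come from a general fact about a continuous convex `f` with nonempty compact
subdifferential `S` not containing `0`: `statDim` of the descent cone is at most `⨅ τ, expSqDist S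
τ`, and this infimum exceeds it by at most `2`. The matrix-specific error terms are both at least
`2`, so nothing finer is needed.

By polarity, the norm of the projection of `g` onto the closed descent cone equals the distance from
`g` to the cone generated by `S`, that is, the minimum over `τ ≥ 0` of the distance to `τ • S`. The
upper bound is then `𝔼 min ≤ min 𝔼`; the content of the lower bound is the converse up to `2`
(`iInf_expSqDist_le`).

For the converse, half the squared distance to `τ • S` is jointly convex in the parameter and the
point and `1`-smooth in the point; a small term `η / 2 * τ ^ 2` makes it strongly convex in `τ`, and
mollification makes its `τ`-derivative `B` smooth. The standard Gaussian is a sum of `M` independent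
Gaussians of covariance `1 / M`. In one small step from `x`, keep the parameter `τ` that is optimal
at `x`. Orthogonally to the gradient of `B τ` at `x`, `τ` stays optimal up to fourth order in the
displacement; along the gradient, convexity and smoothness bound the loss by the square of the
displacement (`IsRegularFamily.excess_le`). Only one direction contributes at second order, so a
step costs `1 / M + O(1 / M ^ 2)` whatever the dimension. Averaging keeps all constants of the
family, so the steps can be iterated, with total cost `1 + O(1 / M)`. Undoing the factor one half
gives `2`. -/

set_option linter.unusedSectionVars false

/-! ### Regular families of functions and their stability under averaging. -/

section RegularFamily

variable {E : Type*} [NormedAddCommGroup E] [InnerProductSpace ℝ E]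

/-- A family `Φ τ`, `τ ≥ 0`, of functions that is jointly convex, `1`-smooth in the space variable
and `η`-strongly convex in the parameter with derivative `B`, of at most quadratic growth. -/
structure IsRegularFamily [MeasurableSpace E] (Φ B : ℝ → E → ℝ) (η : ℝ) : Prop where
  convex : ∀ τ σ : ℝ, 0 ≤ τ → 0 ≤ σ → ∀ (x y : E) (a b : ℝ), 0 ≤ a → 0 ≤ b → a + b = 1 →
    Φ (a * τ + b * σ) (a • x + b • y) ≤ a * Φ τ x + b * Φ σ y
  smooth : ∀ τ : ℝ, 0 ≤ τ → ∀ (x y : E) (a b : ℝ), 0 ≤ a → 0 ≤ b → a + b = 1 →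
    a * Φ τ x + b * Φ τ y ≤ Φ τ (a • x + b • y) + a * b / 2 * ‖x - y‖ ^ 2
  subgradient : ∀ τ σ : ℝ, 0 ≤ τ → 0 ≤ σ → ∀ x : E,
    Φ τ x + B τ x * (σ - τ) + η / 2 * (σ - τ) ^ 2 ≤ Φ σ x
  continuousOn : ∀ x : E, ContinuousOn (fun τ => B τ x) (Set.Ici 0)
  measurable : ∀ τ : ℝ, 0 ≤ τ → Measurable (Φ τ) ∧ Measurable (B τ)
  growth : ∃ A : ℝ, 0 ≤ A ∧ ∀ τ : ℝ, 0 ≤ τ → ∀ x : E,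
    |Φ τ x| ≤ A * (1 + τ ^ 2 + ‖x‖ ^ 2) ∧ |B τ x| ≤ A * (1 + τ ^ 2 + ‖x‖ ^ 2)

/-- A first-order expansion of `B τ` with quadratic remainder, uniform in the base point. -/
structure HasUniformExpansion [MeasurableSpace E] (B : ℝ → E → ℝ) (b : ℝ → E → E) (C : ℝ) :
    Prop where
  measurable : ∀ τ : ℝ, 0 ≤ τ → Measurable (b τ)
  bounded : ∃ L : ℝ, ∀ τ : ℝ, 0 ≤ τ → ∀ x : E, ‖b τ x‖ ≤ L
  expansion : ∀ τ : ℝ, 0 ≤ τ → ∀ x w : E, |B τ (x + w) - B τ x - ⟪b τ x, w⟫| ≤ C * ‖w‖ ^ 2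

/-- The translation average of `f` with respect to `ν`. -/
noncomputable def avg [MeasurableSpace E] {F : Type*} [NormedAddCommGroup F] [NormedSpace ℝ F]
    (ν : Measure E) (f : E → F) (x : E) : F := ∫ w, f (x + w) ∂ν

section Average

variable [MeasurableSpace E] [BorelSpace E] [FiniteDimensional ℝ E]
  {ν : Measure E} [IsProbabilityMeasure ν]

theorem measurable_avg {F : Type*} [NormedAddCommGroup F] [NormedSpace ℝ F]
    [MeasurableSpace F] [BorelSpace F] [SecondCountableTopology F] {f : E → F} (hf : Measurable f) :
    Measurable (avg ν f) := by
  have h : StronglyMeasurable (Function.uncurry fun x w : E => f (x + w)) :=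
    (hf.comp (measurable_fst.add measurable_snd)).stronglyMeasurable
  exact h.integral_prod_right.measurable

theorem integrable_of_growth (hν : Integrable (fun w : E => ‖w‖ ^ 2) ν) {f : E → ℝ}
    (hf : Measurable f) {A c : ℝ} (h : ∀ x, |f x| ≤ A * (c + ‖x‖ ^ 2)) : Integrable f ν := by
  refine Integrable.mono' (((integrable_const c).add hν).const_mul A) hf.aestronglyMeasurable ?_
  exact Filter.Eventually.of_forall fun x => by simpa using h x

theorem growth_add {f : E → ℝ} {A c : ℝ} (hA : 0 ≤ A) (h : ∀ x, |f x| ≤ A * (c + ‖x‖ ^ 2))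
    (x w : E) : |f (x + w)| ≤ (2 * A) * ((c / 2 + ‖x‖ ^ 2) + ‖w‖ ^ 2) := by
  refine (h _).trans ?_
  have h1 : ‖x + w‖ ^ 2 ≤ 2 * ‖x‖ ^ 2 + 2 * ‖w‖ ^ 2 := by
    have := norm_add_le x w
    nlinarith [norm_nonneg (x + w), sq_nonneg (‖x‖ - ‖w‖)]
  nlinarith

theorem integrable_translate (hν : Integrable (fun w : E => ‖w‖ ^ 2) ν) {f : E → ℝ}
    (hf : Measurable f) {A c : ℝ} (hA : 0 ≤ A) (h : ∀ x, |f x| ≤ A * (c + ‖x‖ ^ 2)) (x : E) :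
    Integrable (fun w => f (x + w)) ν :=
  integrable_of_growth hν (hf.comp (measurable_const_add x)) (growth_add hA h x)

theorem growth_avg (hν : Integrable (fun w : E => ‖w‖ ^ 2) ν) {f : E → ℝ}
    (hf : Measurable f) {A c : ℝ} (hA : 0 ≤ A) (h : ∀ x, |f x| ≤ A * (c + ‖x‖ ^ 2)) (x : E) :
    |avg ν f x| ≤ (2 * A) * ((c / 2 + ‖x‖ ^ 2) + ∫ w, ‖w‖ ^ 2 ∂ν) := by
  have h1 : |avg ν f x| ≤ ∫ w, |f (x + w)| ∂ν := abs_integral_le_integral_abs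
  refine h1.trans ?_
  calc ∫ w, |f (x + w)| ∂ν ≤ ∫ w, (2 * A) * ((c / 2 + ‖x‖ ^ 2) + ‖w‖ ^ 2) ∂ν :=
        integral_mono (integrable_translate hν hf hA h x).abs
          (((integrable_const _).add hν).const_mul _) (growth_add hA h x)
    _ = _ := by
        rw [integral_const_mul, integral_add (integrable_const _) hν]
        simp

namespace IsRegularFamily

variable {Φ B : ℝ → E → ℝ} {η : ℝ}

theorem integrable_fun (h : IsRegularFamily Φ B η) (hν : Integrable (fun w : E => ‖w‖ ^ 2) ν)
    {τ : ℝ} (hτ : 0 ≤ τ) (x : E) : Integrable (fun w => Φ τ (x + w)) ν := by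
  obtain ⟨A, hA, hg⟩ := h.growth
  exact integrable_translate hν (h.measurable τ hτ).1 hA (fun x => (hg τ hτ x).1) x

theorem integrable_deriv (h : IsRegularFamily Φ B η) (hν : Integrable (fun w : E => ‖w‖ ^ 2) ν)
    {τ : ℝ} (hτ : 0 ≤ τ) (x : E) : Integrable (fun w => B τ (x + w)) ν := by
  obtain ⟨A, hA, hg⟩ := h.growth
  exact integrable_translate hν (h.measurable τ hτ).2 hA (fun x => (hg τ hτ x).2) x

/-- Every defining inequality is linear in the functions and invariant under translation, so it
survives integration with the same `η`. Only the growth constant, which never enters the final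
estimate, deteriorates. -/
theorem average (h : IsRegularFamily Φ B η) (hν : Integrable (fun w : E => ‖w‖ ^ 2) ν) :
    IsRegularFamily (fun τ => avg ν (Φ τ)) (fun τ => avg ν (B τ)) η where
  convex τ σ hτ hσ x y a b ha hb hab := by
    have hm : 0 ≤ a * τ + b * σ := by positivity
    simp only [avg]
    rw [← integral_const_mul, ← integral_const_mul,
      ← integral_add ((h.integrable_fun hν hτ x).const_mul _)
        ((h.integrable_fun hν hσ y).const_mul _)]
    refine integral_mono (h.integrable_fun hν hm _) (((h.integrable_fun hν hτ x).const_mul _).add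
        ((h.integrable_fun hν hσ y).const_mul _)) fun w => ?_
    have e : a • x + b • y + w = a • (x + w) + b • (y + w) := by
      have : w = (a + b) • w := by rw [hab, one_smul]
      nth_rewrite 1 [this]; module
    simpa only [e] using h.convex τ σ hτ hσ (x + w) (y + w) a b ha hb hab
  smooth τ hτ x y a b ha hb hab := by
    simp only [avg]
    rw [← integral_const_mul, ← integral_const_mul,
      ← integral_add ((h.integrable_fun hν hτ x).const_mul _)
        ((h.integrable_fun hν hτ y).const_mul _)]
    have e2 : ∫ w, (Φ τ (a • x + b • y + w) + a * b / 2 * ‖x - y‖ ^ 2) ∂ν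
        = ∫ w, Φ τ (a • x + b • y + w) ∂ν + a * b / 2 * ‖x - y‖ ^ 2 := by
      rw [integral_add (h.integrable_fun hν hτ _) (integrable_const _)]; simp
    rw [← e2]
    refine integral_mono (((h.integrable_fun hν hτ x).const_mul _).add
        ((h.integrable_fun hν hτ y).const_mul _))
        ((h.integrable_fun hν hτ _).add (integrable_const _)) fun w => ?_
    have e : a • x + b • y + w = a • (x + w) + b • (y + w) := by
      have : w = (a + b) • w := by rw [hab, one_smul]
      nth_rewrite 1 [this]; module
    have := h.smooth τ hτ (x + w) (y + w) a b ha hb hab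
    rw [add_sub_add_right_eq_sub] at this
    simpa only [e] using this
  subgradient τ σ hτ hσ x := by
    simp only [avg]
    have e : ∫ w, (Φ τ (x + w) + B τ (x + w) * (σ - τ) + η / 2 * (σ - τ) ^ 2) ∂ν
        = ∫ w, Φ τ (x + w) ∂ν + (∫ w, B τ (x + w) ∂ν) * (σ - τ) + η / 2 * (σ - τ) ^ 2 := by
      have h1 : Integrable (fun w => Φ τ (x + w) + B τ (x + w) * (σ - τ)) ν :=
        (h.integrable_fun hν hτ x).add ((h.integrable_deriv hν hτ x).mul_const _)
      rw [integral_add h1 (integrable_const _), integral_add (h.integrable_fun hν hτ x) ((h.integrable_deriv hν hτ x).mul_const _),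
        integral_mul_const]
      simp
    rw [← e]
    exact integral_mono (((h.integrable_fun hν hτ x).add
        ((h.integrable_deriv hν hτ x).mul_const _)).add (integrable_const _))
        (h.integrable_fun hν hσ x) fun w => h.subgradient τ σ hτ hσ (x + w)
  continuousOn x := by
    obtain ⟨A, hA, hg⟩ := h.growth
    intro (t : ℝ) ht
    have ht' : (0 : ℝ) ≤ t := ht
    refine continuousWithinAt_of_dominated
      (bound := fun w => A * ((1 + (t + 1) ^ 2) + ‖x + w‖ ^ 2)) ?_ ?_ ?_ ?_
    · filter_upwards [self_mem_nhdsWithin] with s hs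
      exact (h.integrable_deriv hν hs x).aestronglyMeasurable
    · have : ∀ᶠ s : ℝ in nhdsWithin t (Set.Ici (0 : ℝ)), s < t + 1 :=
        nhdsWithin_le_nhds (eventually_lt_nhds (lt_add_one t))
      filter_upwards [self_mem_nhdsWithin, this] with s hs hs1
      refine Filter.Eventually.of_forall fun w => ?_
      have hs0 : (0 : ℝ) ≤ s := hs
      have h1 := (hg s hs (x + w)).2
      rw [Real.norm_eq_abs]
      refine h1.trans (mul_le_mul_of_nonneg_left ?_ hA)
      have : s ^ 2 ≤ (t + 1) ^ 2 := by gcongr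
      linarith
    · refine integrable_translate (f := fun w => A * ((1 + (t + 1) ^ 2) + ‖w‖ ^ 2))
        (A := A) (c := 1 + (t + 1) ^ 2) hν (by fun_prop) hA (fun w => ?_) x
      rw [abs_of_nonneg (by positivity)]
    · exact Filter.Eventually.of_forall fun w => h.continuousOn (x + w) t ht
  measurable τ hτ := ⟨measurable_avg (h.measurable τ hτ).1, measurable_avg (h.measurable τ hτ).2⟩
  growth := by
    obtain ⟨A, hA, hg⟩ := h.growth
    have hm : 0 ≤ ∫ w, ‖w‖ ^ 2 ∂ν := integral_nonneg fun w => by positivity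
    have key : ∀ τ : ℝ, ∀ x : E, (2 * A) * (((1 + τ ^ 2) / 2 + ‖x‖ ^ 2) + ∫ w, ‖w‖ ^ 2 ∂ν)
        ≤ 2 * A * (1 + ∫ w, ‖w‖ ^ 2 ∂ν) * (1 + τ ^ 2 + ‖x‖ ^ 2) := fun τ x => by
      rw [mul_assoc (2 * A) (1 + ∫ w, ‖w‖ ^ 2 ∂ν)]
      refine mul_le_mul_of_nonneg_left ?_ (by positivity)
      have h1 : 0 ≤ (∫ w, ‖w‖ ^ 2 ∂ν) * (τ ^ 2 + ‖x‖ ^ 2) := by positivity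
      nlinarith [sq_nonneg τ]
    refine ⟨2 * A * (1 + ∫ w, ‖w‖ ^ 2 ∂ν), by positivity, fun τ hτ x => ⟨?_, ?_⟩⟩
    · exact (growth_avg hν (h.measurable τ hτ).1 hA (fun x => (hg τ hτ x).1) x).trans (key τ x)
    · exact (growth_avg hν (h.measurable τ hτ).2 hA (fun x => (hg τ hτ x).2) x).trans (key τ x)

end IsRegularFamily

/-- The remainder bound does not depend on the base point, so the average keeps the same `C`;
otherwise errors could accumulate over the steps. -/
theorem HasUniformExpansion.average {Φ B : ℝ → E → ℝ} {η : ℝ} {b : ℝ → E → E} {C : ℝ}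
    (h : IsRegularFamily Φ B η) (hν : Integrable (fun w : E => ‖w‖ ^ 2) ν)
    (hb : HasUniformExpansion B b C) :
    HasUniformExpansion (fun τ => avg ν (B τ)) (fun τ => avg ν (b τ)) C where
  measurable τ hτ := measurable_avg (hb.measurable τ hτ)
  bounded := by
    obtain ⟨L, hL⟩ := hb.bounded
    refine ⟨L, fun τ hτ x => ?_⟩
    have := norm_integral_le_of_norm_le_const (μ := ν) (f := fun w => b τ (x + w)) (C := L)
      (Filter.Eventually.of_forall fun w => hL τ hτ (x + w))
    simpa [avg] using this
  expansion τ hτ x w := by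
    obtain ⟨L, hL⟩ := hb.bounded
    have hi : Integrable (fun v => b τ (x + v)) ν :=
      Integrable.of_bound ((hb.measurable τ hτ).comp (measurable_const_add x)).aestronglyMeasurable
        L (Filter.Eventually.of_forall fun v => hL τ hτ (x + v))
    have e : avg ν (B τ) (x + w) - avg ν (B τ) x - ⟪avg ν (b τ) x, w⟫
        = ∫ v, (B τ (x + v + w) - B τ (x + v) - ⟪b τ (x + v), w⟫) ∂ν := by
      have h1 := h.integrable_deriv hν hτ (x + w)
      simp only [add_right_comm x w] at h1
      have h2 : Integrable (fun v => B τ (x + v + w) - B τ (x + v)) ν :=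
        h1.sub (h.integrable_deriv hν hτ x)
      rw [integral_sub h2 (hi.inner_const w), integral_sub h1 (h.integrable_deriv hν hτ x)]
      congr 1
      · simp only [avg, add_right_comm x w]
      · rw [avg, real_inner_comm, ← integral_inner hi]
        simp only [real_inner_comm]
    rw [e]
    have := norm_integral_le_of_norm_le_const (μ := ν) (C := C * ‖w‖ ^ 2)
      (f := fun v => B τ (x + v + w) - B τ (x + v) - ⟪b τ (x + v), w⟫)
      (Filter.Eventually.of_forall fun v => hb.expansion τ hτ (x + v) w)
    simpa using this

end Average

end RegularFamily

/-! ### Exchanging minimum and Gaussian average in small steps. -/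

section HeatFlow

variable {E : Type*} [NormedAddCommGroup E] [InnerProductSpace ℝ E] [MeasurableSpace E]
  [BorelSpace E] [FiniteDimensional ℝ E]

namespace IsRegularFamily

variable {Φ B : ℝ → E → ℝ} {η : ℝ}

/-- The conclusion is the first-order condition for a minimum over `τ ≥ 0`. If `B 0 x < 0`, strong
monotonicity of `B` in the parameter makes it nonnegative at `-B 0 x / η`, and a zero lies in
between. -/
theorem exists_critical (h : IsRegularFamily Φ B η) (hη : 0 < η) (x : E) :
    ∃ τ : ℝ, 0 ≤ τ ∧ ∀ σ : ℝ, 0 ≤ σ → 0 ≤ B τ x * (σ - τ) := by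
  by_cases h0 : 0 ≤ B 0 x
  · exact ⟨0, le_rfl, fun σ hσ => by rw [sub_zero]; positivity⟩
  push Not at h0
  set T := -B 0 x / η with hT
  have hTpos : 0 < T := div_pos (by linarith) hη
  have hBT : 0 ≤ B T x := by
    have h1 := h.subgradient 0 T le_rfl hTpos.le x
    have h2 := h.subgradient T 0 hTpos.le le_rfl x
    have h3 : η * T = -B 0 x := by rw [hT]; field_simp
    have h4 : 0 ≤ B T x * T := by nlinarith
    exact nonneg_of_mul_nonneg_left h4 hTpos
  obtain ⟨τ, hτ, hz⟩ := intermediate_value_Icc hTpos.le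
    ((h.continuousOn x).mono Set.Icc_subset_Ici_self) (show (0 : ℝ) ∈ Set.Icc _ _ from ⟨h0.le, hBT⟩)
  refine ⟨τ, hτ.1, fun σ _ => ?_⟩
  simp only at hz
  rw [hz, zero_mul]

/-- Doubling estimate for the excess of `Φ τ` over the lower envelope of the family. -/
theorem excess_add_le (h : IsRegularFamily Φ B η) {τ D : ℝ} (hτ : 0 ≤ τ) (v k : E)
    (hv : ∀ σ : ℝ, 0 ≤ σ → Φ τ v ≤ Φ σ v + D) {σ₁ σ₂ : ℝ} (h₁ : 0 ≤ σ₁) (h₂ : 0 ≤ σ₂)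
    (hmin : Φ σ₂ (v - k) ≤ Φ τ (v - k)) :
    Φ τ (v + k) ≤ Φ σ₁ (v + k) + 2 * D + ‖k‖ ^ 2 := by
  have e : (1 / 2 : ℝ) • (v + k) + (1 / 2 : ℝ) • (v - k) = v := by module
  have e' : (v + k) - (v - k) = (2 : ℝ) • k := by module
  have c := h.convex σ₁ σ₂ h₁ h₂ (v + k) (v - k) (1 / 2) (1 / 2) (by norm_num) (by norm_num)
    (by norm_num)
  have s := h.smooth τ hτ (v + k) (v - k) (1 / 2) (1 / 2) (by norm_num) (by norm_num) (by norm_num)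
  rw [e] at c
  rw [e, e', norm_smul, Real.norm_eq_abs, abs_of_pos (by norm_num : (0 : ℝ) < 2)] at s
  -- The midpoint parameter is the one that joint convexity produces at `v`, the midpoint of `v + k`
  -- and `v - k`. The excess at `v - k` is nonnegative by `hmin` and can be dropped.
  have := hv (1 / 2 * σ₁ + 1 / 2 * σ₂) (by positivity)
  nlinarith

/-- If `B τ` has moved little since the point `x` where `τ` was critical, then `τ` is still nearly
optimal: strong convexity absorbs the change by completing the square. -/
theorem le_add_of_critical (h : IsRegularFamily Φ B η) (hη : 0 < η) {τ σ : ℝ} (hτ : 0 ≤ τ)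
    (hσ : 0 ≤ σ) {x : E} (hcrit : 0 ≤ B τ x * (σ - τ)) (v : E) :
    Φ τ v ≤ Φ σ v + (B τ v - B τ x) ^ 2 / (2 * η) := by
  have h1 := h.subgradient τ σ hτ hσ v
  have h2 : 0 ≤ (B τ v - B τ x) ^ 2 / (2 * η) + (B τ v - B τ x) * (σ - τ)
      + η / 2 * (σ - τ) ^ 2 := by
    have : (B τ v - B τ x) ^ 2 / (2 * η) + (B τ v - B τ x) * (σ - τ) + η / 2 * (σ - τ) ^ 2
        = (B τ v - B τ x + η * (σ - τ)) ^ 2 / (2 * η) := by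
      field_simp; ring
    rw [this]; positivity
  nlinarith

/-- Pointwise bound of the excess of `Φ τ` over the lower envelope, at a critical parameter `τ`:
to second order it only grows in one direction. -/
theorem excess_le (h : IsRegularFamily Φ B η) (hη : 0 < η) {b : ℝ → E → E} {C : ℝ}
    (hb : HasUniformExpansion B b C) (x : E) :
    ∃ τ : ℝ, 0 ≤ τ ∧ ∃ n : E, ‖n‖ ≤ 1 ∧ ∀ (w : E) (σ : ℝ), 0 ≤ σ →
      Φ τ (x + w) ≤ Φ σ (x + w) + ⟪n, w⟫ ^ 2 + C ^ 2 / η * ‖w‖ ^ 4 := by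
  obtain ⟨τ, hτ, hcrit⟩ := h.exists_critical hη x
  -- This is the unit gradient direction of `B τ` at `x`, or `0` if the gradient vanishes; hence
  -- only `‖n‖ ≤ 1` is claimed.
  set n : E := ‖b τ x‖⁻¹ • b τ x with hn
  have hn1 : ‖n‖ ≤ 1 := by
    rw [hn, norm_smul, norm_inv, norm_norm]
    exact inv_mul_le_one
  have hbn : ∀ w : E, ⟪b τ x, w - ⟪n, w⟫ • n⟫ = 0 := fun w => by
    by_cases h0 : b τ x = 0
    · simp [h0]
    have hne : ‖b τ x‖ ≠ 0 := norm_ne_zero_iff.2 h0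
    rw [hn, inner_sub_right, inner_smul_right, inner_smul_right, real_inner_smul_left,
      real_inner_self_eq_norm_sq]
    field_simp
    ring
  have hperp : ∀ w : E, ‖w - ⟪n, w⟫ • n‖ ≤ ‖w‖ := fun w => by
    refine abs_le_of_sq_le_sq' ?_ (norm_nonneg _) |>.2
    rw [norm_sub_sq_real, inner_smul_right, norm_smul, mul_pow, Real.norm_eq_abs, sq_abs,
      real_inner_comm]
    have : ‖n‖ ^ 2 ≤ 1 := pow_le_one₀ (norm_nonneg _) hn1
    nlinarith [mul_le_mul_of_nonneg_left this (sq_nonneg ⟪w, n⟫), sq_nonneg ⟪w, n⟫]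
  refine ⟨τ, hτ, n, hn1, fun w σ hσ => ?_⟩
  -- Along `p` the first-order change of `B τ` is zero, so its square is of fourth order. The
  -- remaining displacement `k` is handled by the doubling estimate around `x + p`.
  set p := w - ⟪n, w⟫ • n with hp
  set k := ⟪n, w⟫ • n with hk
  have hD : ∀ σ : ℝ, 0 ≤ σ → Φ τ (x + p) ≤ Φ σ (x + p) + C ^ 2 / (2 * η) * ‖w‖ ^ 4 := by
    intro σ hσ
    refine (h.le_add_of_critical hη hτ hσ (hcrit σ hσ) (x + p)).trans ?_
    have he := hb.expansion τ hτ x p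
    rw [hbn w, sub_zero] at he
    have he' : (B τ (x + p) - B τ x) ^ 2 ≤ C ^ 2 * ‖w‖ ^ 4 := by
      have h1 : (B τ (x + p) - B τ x) ^ 2 ≤ (C * ‖p‖ ^ 2) ^ 2 := sq_le_sq' (abs_le.1 he).1
        (abs_le.1 he).2
      refine h1.trans ?_
      rw [mul_pow, ← pow_mul]
      exact mul_le_mul_of_nonneg_left (pow_le_pow_left₀ (norm_nonneg _) (hperp w) 4)
        (sq_nonneg C)
    rw [div_mul_eq_mul_div]
    gcongr
  -- A parameter critical at the point itself minimizes the family there, since the error term of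
  -- `le_add_of_critical` vanishes.
  obtain ⟨σ₂, hσ₂, hc₂⟩ := h.exists_critical hη (x + p - k)
  have hmin : Φ σ₂ (x + p - k) ≤ Φ τ (x + p - k) := by
    have := h.le_add_of_critical hη hσ₂ hτ (hc₂ τ hτ) (x + p - k)
    simpa using this
  have key := h.excess_add_le hτ (x + p) k hD hσ hσ₂ hmin
  have e : x + p + k = x + w := by rw [hp]; abel
  rw [e] at key
  have hk2 : ‖k‖ ^ 2 ≤ ⟪n, w⟫ ^ 2 := by
    rw [hk, norm_smul, mul_pow, Real.norm_eq_abs, sq_abs]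
    exact mul_le_of_le_one_right (sq_nonneg _) (pow_le_one₀ (norm_nonneg _) hn1)
  have e2 : 2 * (C ^ 2 / (2 * η) * ‖w‖ ^ 4) = C ^ 2 / η * ‖w‖ ^ 4 := by field_simp
  linarith

variable {ν : Measure E} [IsProbabilityMeasure ν]

/-- Averaging and minimizing over the parameter commute up to the second moment of `ν` in one
direction and a fourth-order term. -/
theorem exists_avg_le (h : IsRegularFamily Φ B η) (hη : 0 < η) {b : ℝ → E → E} {C : ℝ}
    (hb : HasUniformExpansion B b C) {ε m : ℝ}
    (hν₄ : Integrable (fun w : E => ‖w‖ ^ 4) ν) (hm : ∫ w, ‖w‖ ^ 4 ∂ν ≤ m)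
    (hν : Integrable (fun w : E => ‖w‖ ^ 2) ν) (hε : ∀ n : E, ∫ w, ⟪n, w⟫ ^ 2 ∂ν ≤ ε * ‖n‖ ^ 2)
    (hε0 : 0 ≤ ε) {u : E → ℝ} (hu : ∀ x, Integrable (fun w => u (x + w)) ν)
    (hle : ∀ y, ∃ τ : ℝ, 0 ≤ τ ∧ Φ τ y ≤ u y) (x : E) :
    ∃ τ : ℝ, 0 ≤ τ ∧ avg ν (Φ τ) x ≤ avg ν u x + (ε + C ^ 2 / η * m) := by
  obtain ⟨τ, hτ, n, hn, hτn⟩ := h.excess_le hη hb x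
  refine ⟨τ, hτ, ?_⟩
  have hin : Integrable (fun w : E => ⟪n, w⟫ ^ 2) ν := by
    refine hν.mono' (by fun_prop) (Filter.Eventually.of_forall fun w => ?_)
    rw [Real.norm_eq_abs, abs_of_nonneg (sq_nonneg _)]
    have h1 : |⟪n, w⟫| ≤ ‖w‖ := (abs_real_inner_le_norm n w).trans
      (mul_le_of_le_one_left (norm_nonneg _) hn)
    rw [← sq_abs]
    gcongr
  have h2 : Integrable (fun w => u (x + w) + ⟪n, w⟫ ^ 2) ν := (hu x).add hin
  have h1 : avg ν (Φ τ) x ≤ ∫ w, (u (x + w) + ⟪n, w⟫ ^ 2 + C ^ 2 / η * ‖w‖ ^ 4) ∂ν := by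
    refine integral_mono (h.integrable_fun hν hτ x) (h2.add (hν₄.const_mul _)) fun w => ?_
    obtain ⟨σ, hσ, hu'⟩ := hle (x + w)
    have := hτn w σ hσ
    simp only
    linarith
  rw [integral_add h2 (hν₄.const_mul _), integral_add (hu x) hin, integral_const_mul] at h1
  have h3 : ∫ w, ⟪n, w⟫ ^ 2 ∂ν ≤ ε :=
    (hε n).trans (mul_le_of_le_one_right hε0 (pow_le_one₀ (norm_nonneg _) hn))
  have h4 : C ^ 2 / η * ∫ w, ‖w‖ ^ 4 ∂ν ≤ C ^ 2 / η * m :=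
    mul_le_mul_of_nonneg_left hm (by positivity)
  have : avg ν u x = ∫ w, u (x + w) ∂ν := rfl
  linarith

end IsRegularFamily

/-! ### Moments and convolution of scaled Gaussian measures. -/

section Gaussian

variable (E) in
/-- The centred Gaussian measure with covariance `c ^ 2` times the identity. -/
noncomputable def scaledGaussian (c : ℝ) : Measure E := (stdGaussian E).map (fun x => c • x)

instance (c : ℝ) : IsProbabilityMeasure (scaledGaussian E c) :=
  Measure.isProbabilityMeasure_map (by fun_prop)

theorem integrable_norm_pow_stdGaussian (k : ℕ) :
    Integrable (fun w : E => ‖w‖ ^ k) (stdGaussian E) := by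
  rcases Nat.eq_zero_or_pos k with rfl | hk
  · simp
  have := (IsGaussian.memLp_id (stdGaussian E) (k : ENNReal) (by simp)).integrable_norm_pow
    (by omega)
  simpa using this

theorem integral_inner_sq_stdGaussian (n : E) : ∫ w, ⟪n, w⟫ ^ 2 ∂(stdGaussian E) = ‖n‖ ^ 2 := by
  have h := variance_dual_stdGaussian (innerSL ℝ n)
  rw [variance_of_integral_eq_zero (by fun_prop) (integral_strongDual_stdGaussian _)] at h
  simpa [innerSL_apply_norm] using h

theorem integrable_norm_pow_scaledGaussian (c : ℝ) (k : ℕ) :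
    Integrable (fun w : E => ‖w‖ ^ k) (scaledGaussian E c) := by
  rw [scaledGaussian, integrable_map_measure (by fun_prop) (by fun_prop)]
  have := (integrable_norm_pow_stdGaussian (E := E) k).const_mul (|c| ^ k)
  refine this.congr (Filter.Eventually.of_forall fun w => ?_)
  simp [norm_smul, mul_pow]

theorem integral_norm_pow_four_scaledGaussian (c : ℝ) :
    ∫ w, ‖w‖ ^ 4 ∂(scaledGaussian E c) = c ^ 4 * ∫ w, ‖w‖ ^ 4 ∂(stdGaussian E) := by
  rw [scaledGaussian, integral_map (by fun_prop) (by fun_prop), ← integral_const_mul]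
  refine integral_congr_ae (Filter.Eventually.of_forall fun w => ?_)
  simp only [norm_smul, mul_pow, Real.norm_eq_abs]
  rw [show |c| ^ 4 = c ^ 4 from Even.pow_abs (by decide) c]

theorem integral_inner_sq_scaledGaussian (c : ℝ) (n : E) :
    ∫ w, ⟪n, w⟫ ^ 2 ∂(scaledGaussian E c) = c ^ 2 * ‖n‖ ^ 2 := by
  rw [scaledGaussian, integral_map (by fun_prop) (by fun_prop), ← integral_inner_sq_stdGaussian,
    ← integral_const_mul]
  refine integral_congr_ae (Filter.Eventually.of_forall fun w => ?_)
  simp only [inner_smul_right, mul_pow]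

theorem charFun_scaledGaussian (c : ℝ) (t : E) :
    charFun (scaledGaussian E c) t = Complex.exp (-(c ^ 2 * ‖t‖ ^ 2) / 2) := by
  rw [scaledGaussian, charFun_map_smul, charFun_stdGaussian, norm_smul]
  congr 2
  rw [← Complex.ofReal_pow, mul_pow, Real.norm_eq_abs, sq_abs]
  push_cast
  ring

theorem scaledGaussian_conv {a b c : ℝ} (h : a ^ 2 + b ^ 2 = c ^ 2) :
    (scaledGaussian E a).conv (scaledGaussian E b) = scaledGaussian E c := by
  apply Measure.ext_of_charFun
  ext t
  rw [charFun_conv, charFun_scaledGaussian, charFun_scaledGaussian, charFun_scaledGaussian,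
    ← Complex.exp_add]
  congr 1
  have : ((c : ℂ)) ^ 2 = (a : ℂ) ^ 2 + (b : ℂ) ^ 2 := by exact_mod_cast h.symm
  rw [this]
  ring

theorem integral_avg_scaledGaussian {a b c : ℝ} (h : a ^ 2 + b ^ 2 = c ^ 2) {f : E → ℝ}
    (hf : Integrable f (scaledGaussian E c)) :
    ∫ x, avg (scaledGaussian E b) f x ∂(scaledGaussian E a) = ∫ x, f x ∂(scaledGaussian E c) := by
  rw [← scaledGaussian_conv h] at hf ⊢
  rw [integral_conv hf]
  rfl

end Gaussian

/-- Averaging with a Gaussian measure of covariance `k * c ^ 2`, in `k` steps. -/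
theorem IsRegularFamily.exists_integral_le_aux {η C c : ℝ} (hη : 0 < η) (k : ℕ) :
    ∀ {Φ B : ℝ → E → ℝ} {b : ℝ → E → E}, IsRegularFamily Φ B η → HasUniformExpansion B b C →
    ∀ {u : E → ℝ}, Measurable u → ∀ {A : ℝ}, 0 ≤ A → (∀ x, |u x| ≤ A * (1 + ‖x‖ ^ 2)) →
    (∀ y, ∃ τ : ℝ, 0 ≤ τ ∧ Φ τ y ≤ u y) →
    ∃ τ : ℝ, 0 ≤ τ ∧ ∫ x, Φ τ x ∂(scaledGaussian E (√k * c))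
      ≤ ∫ x, u x ∂(scaledGaussian E (√k * c))
        + k * (c ^ 2 + C ^ 2 / η * (c ^ 4 * ∫ w, ‖w‖ ^ 4 ∂(stdGaussian E))) := by
  induction k with
  | zero =>
    intro Φ B b h hb u hu A hA hg hle
    obtain ⟨τ, hτ, hl⟩ := hle 0
    refine ⟨τ, hτ, ?_⟩
    -- With no steps the Gaussian has variance zero, and the claim is `hle` at the origin.
    have e : scaledGaussian E (√((0 : ℕ) : ℝ) * c) = Measure.dirac 0 := by
      simp [scaledGaussian, Measure.map_const]
    rw [e, integral_dirac, integral_dirac]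
    simpa using hl
  | succ k ih =>
    intro Φ B b h hb u hu A hA hg hle
    set ν := scaledGaussian E c
    set e := c ^ 2 + C ^ 2 / η * (c ^ 4 * ∫ w, ‖w‖ ^ 4 ∂(stdGaussian E)) with he
    have hν := integrable_norm_pow_scaledGaussian (E := E) c 2
    have hν4 := integrable_norm_pow_scaledGaussian (E := E) c 4
    have hstep := h.exists_avg_le hη hb hν4 (integral_norm_pow_four_scaledGaussian c).le hν
      (fun n => (integral_inner_sq_scaledGaussian c n).le) (sq_nonneg c)
      (fun x => integrable_translate hν hu hA hg x) hle
    have hm : 0 ≤ ∫ w, ‖w‖ ^ 2 ∂ν := integral_nonneg fun w => by positivity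
    have he0 : 0 ≤ e := by
      have : 0 ≤ ∫ w, ‖w‖ ^ 4 ∂(stdGaussian E) := integral_nonneg fun w => by positivity
      positivity
    -- The averaged family stays in the class, and its envelope is bounded by the averaged `u` plus
    -- the cost `e` of one step.
    obtain ⟨τ, hτ, hi⟩ := ih (h.average hν) (hb.average h hν)
      (u := fun x => avg ν u x + e) ((measurable_avg hu).add_const _)
      (A := 2 * A * (1 + ∫ w, ‖w‖ ^ 2 ∂ν) + e) (by positivity) (fun x => by
        have h1 := growth_avg hν hu hA hg x
        have h2 : |avg ν u x + e| ≤ |avg ν u x| + e := by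
          simpa [abs_of_nonneg he0] using abs_add_le (avg ν u x) e
        have h3 : 0 ≤ A * ((∫ w, ‖w‖ ^ 2 ∂ν) * ‖x‖ ^ 2) := by positivity
        nlinarith [mul_nonneg he0 (sq_nonneg ‖x‖)]) hstep
    refine ⟨τ, hτ, ?_⟩
    have hs : (√k * c) ^ 2 + c ^ 2 = (√((k + 1 : ℕ) : ℝ) * c) ^ 2 := by
      rw [mul_pow, mul_pow, Real.sq_sqrt (by positivity), Real.sq_sqrt (by positivity)]
      push_cast; ring
    obtain ⟨A', hA', hg'⟩ := h.growth
    rw [integral_avg_scaledGaussian hs (integrable_of_growth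
      (integrable_norm_pow_scaledGaussian _ 2) (h.measurable τ hτ).1
      (fun x => (hg' τ hτ x).1))] at hi
    rw [integral_add _ (integrable_const _), integral_avg_scaledGaussian hs (integrable_of_growth
      (integrable_norm_pow_scaledGaussian _ 2) hu hg)] at hi
    · simp only [integral_const, probReal_univ, one_smul] at hi
      push_cast at hi ⊢
      linarith
    · exact integrable_of_growth (integrable_norm_pow_scaledGaussian _ 2) (measurable_avg hu)
        (A := 2 * A) (c := 1 / 2 + ∫ w, ‖w‖ ^ 2 ∂ν) fun x => by
          have := growth_avg hν hu hA hg x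
          linarith

/-- For a regular family, averaging with the standard Gaussian measure and minimizing over the
parameter commute up to an error that exceeds `1` by an arbitrarily small amount. -/
theorem IsRegularFamily.exists_integral_le {Φ B : ℝ → E → ℝ} {b : ℝ → E → E} {η C : ℝ}
    (hη : 0 < η) (h : IsRegularFamily Φ B η) (hb : HasUniformExpansion B b C) {u : E → ℝ}
    (hu : Measurable u) {A : ℝ} (hA : 0 ≤ A) (hg : ∀ x, |u x| ≤ A * (1 + ‖x‖ ^ 2))
    (hle : ∀ y, ∃ τ : ℝ, 0 ≤ τ ∧ Φ τ y ≤ u y) {δ : ℝ} (hδ : 0 < δ) :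
    ∃ τ : ℝ, 0 ≤ τ ∧ ∫ x, Φ τ x ∂(stdGaussian E) ≤ ∫ x, u x ∂(stdGaussian E) + 1 + δ := by
  set K := C ^ 2 / η * ∫ w, ‖w‖ ^ 4 ∂(stdGaussian E) with hK
  obtain ⟨M, hM⟩ := exists_nat_gt (max 1 (K / δ))
  have hM1 : (1 : ℝ) < M := (le_max_left _ _).trans_lt hM
  have hM0 : (0 : ℝ) < M := by linarith
  have hMK : K / M ≤ δ := by
    have := (le_max_right _ _).trans_lt hM
    rw [div_lt_iff₀ hδ] at this
    rw [div_le_iff₀ hM0]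
    linarith
  -- With step size `1 / √M`, the `M` second-order costs add up to `1` and the fourth-order costs to
  -- `K / M ≤ δ`.
  obtain ⟨τ, hτ, hi⟩ := IsRegularFamily.exists_integral_le_aux (c := (√M)⁻¹) hη M h hb hu hA hg hle
  have e1 : √(M : ℝ) * (√M)⁻¹ = 1 := mul_inv_cancel₀ (Real.sqrt_ne_zero'.2 hM0)
  have e2 : scaledGaussian E 1 = stdGaussian E := by simp [scaledGaussian]
  rw [e1, e2] at hi
  refine ⟨τ, hτ, hi.trans ?_⟩
  have s2 : ((√(M : ℝ))⁻¹) ^ 2 = (M : ℝ)⁻¹ := by rw [inv_pow, Real.sq_sqrt hM0.le]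
  have s4 : ((√(M : ℝ))⁻¹) ^ 4 = (M : ℝ)⁻¹ ^ 2 := by rw [← s2]; ring
  rw [s2, s4]
  have : (M : ℝ) * ((M : ℝ)⁻¹ + C ^ 2 / η * ((M : ℝ)⁻¹ ^ 2 * ∫ w, ‖w‖ ^ 4 ∂(stdGaussian E)))
      = 1 + K / M := by
    rw [hK]; field_simp
  rw [this]
  linarith

end HeatFlow

/-! ### Mollification with a smooth bump. -/

section Mollifier

variable {E : Type*} [NormedAddCommGroup E] [InnerProductSpace ℝ E] [MeasurableSpace E]
  [BorelSpace E] [FiniteDimensional ℝ E]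

/-- The measure with a smooth bump function as its density. -/
noncomputable def bumpMeasure (ρ : ContDiffBump (0 : E)) : Measure E :=
  (Measure.addHaar : Measure E).withDensity fun x => ENNReal.ofReal (ρ.normed Measure.addHaar x)

theorem integral_bumpMeasure (ρ : ContDiffBump (0 : E)) {F : Type*} [NormedAddCommGroup F]
    [NormedSpace ℝ F] (f : E → F) :
    ∫ x, f x ∂(bumpMeasure ρ) = ∫ x, ρ.normed Measure.addHaar x • f x ∂Measure.addHaar := by
  rw [bumpMeasure, integral_withDensity_eq_integral_toReal_smul
    (by have := ρ.continuous_normed (μ := (Measure.addHaar : Measure E)); fun_prop)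
    (Filter.Eventually.of_forall fun x => ENNReal.ofReal_lt_top)]
  simp only [ENNReal.toReal_ofReal (ρ.nonneg_normed _)]

instance (ρ : ContDiffBump (0 : E)) : IsProbabilityMeasure (bumpMeasure ρ) := by
  refine ⟨?_⟩
  rw [bumpMeasure, withDensity_apply _ MeasurableSet.univ, Measure.restrict_univ,
    ← ofReal_integral_eq_lintegral_ofReal ρ.integrable_normed
      (Filter.Eventually.of_forall ρ.nonneg_normed), ρ.integral_normed, ENNReal.ofReal_one]

theorem ae_norm_le_bumpMeasure (ρ : ContDiffBump (0 : E)) :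
    ∀ᵐ x ∂(bumpMeasure ρ), ‖x‖ ≤ ρ.rOut := by
  have hm : Measurable fun x => ENNReal.ofReal (ρ.normed (Measure.addHaar : Measure E) x) := by
    have := ρ.continuous_normed (μ := (Measure.addHaar : Measure E)); fun_prop
  rw [bumpMeasure, ae_withDensity_iff hm]
  refine Filter.Eventually.of_forall fun x hx => ?_
  have h1 : x ∈ Function.support (ρ.normed (Measure.addHaar : Measure E)) := fun h0 => hx (by
    rw [h0, ENNReal.ofReal_zero])
  rw [ρ.support_normed_eq, Metric.mem_ball, dist_zero_right] at h1
  exact h1.le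

theorem integrable_norm_sq_bumpMeasure (ρ : ContDiffBump (0 : E)) :
    Integrable (fun w : E => ‖w‖ ^ 2) (bumpMeasure ρ) := by
  refine Integrable.of_bound (by fun_prop) (ρ.rOut ^ 2) ?_
  filter_upwards [ae_norm_le_bumpMeasure ρ] with x hx
  rw [Real.norm_eq_abs, abs_of_nonneg (by positivity)]
  gcongr

theorem integral_neg_bumpMeasure (ρ : ContDiffBump (0 : E)) (f : E → ℝ) :
    ∫ x, f (-x) ∂(bumpMeasure ρ) = ∫ x, f x ∂(bumpMeasure ρ) := by
  rw [integral_bumpMeasure, integral_bumpMeasure, ← integral_neg_eq_self]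
  simp only [ρ.normed_neg, neg_neg]

/-- Mollified Lipschitz functions are differentiable with a bounded Lipschitz derivative. -/
theorem exists_expansion_avg_bumpMeasure (ρ : ContDiffBump (0 : E)) {L : NNReal} :
    ∃ C : ℝ, ∀ ψ : E → ℝ, LipschitzWith L ψ → ∃ b : E → E, Measurable b ∧ (∀ x, ‖b x‖ ≤ L) ∧
      ∀ x w, |avg (bumpMeasure ρ) ψ (x + w) - avg (bumpMeasure ρ) ψ x - ⟪b x, w⟫|
        ≤ C * ‖w‖ ^ 2 := by
  set μ : Measure E := Measure.addHaar
  set r : E → ℝ := ρ.normed μ with hr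
  have hr1 : ContDiff ℝ 1 r := ρ.contDiff_normed
  have hrc : HasCompactSupport r := ρ.hasCompactSupport_normed
  have hdr : Continuous (fderiv ℝ r) := hr1.continuous_fderiv one_ne_zero
  have hdi : Integrable (fderiv ℝ r) μ := hdr.integrable_of_hasCompactSupport (hrc.fderiv ℝ)
  set C : ℝ := L * ∫ t, ‖fderiv ℝ r t‖ ∂μ with hC
  refine ⟨C, fun ψ hψ => ?_⟩
  set G : E → ℝ := avg (bumpMeasure ρ) ψ with hG
  set D : E → (E →L[ℝ] ℝ) := MeasureTheory.convolution ψ (fderiv ℝ r)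
    ((ContinuousLinearMap.lsmul ℝ ℝ).precompR E) μ with hD
  have hGconv : G = MeasureTheory.convolution ψ r (ContinuousLinearMap.lsmul ℝ ℝ) μ := by
    funext x
    rw [hG, avg, integral_bumpMeasure, convolution_eq_swap, ← integral_neg_eq_self]
    refine integral_congr_ae (Filter.Eventually.of_forall fun t => ?_)
    simp [hr, ρ.normed_neg, sub_eq_add_neg, mul_comm, μ]
  have hder : ∀ x, HasFDerivAt G (D x) x := fun x => by
    rw [hGconv]
    exact hrc.hasFDerivAt_convolution_right (ContinuousLinearMap.lsmul ℝ ℝ)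
      hψ.continuous.locallyIntegrable hr1 x
  have hGL : LipschitzWith L G := by
    refine LipschitzWith.of_dist_le_mul fun x y => ?_
    have hi : ∀ x, Integrable (fun w => ψ (x + w)) (bumpMeasure ρ) := fun x => by
      refine Integrable.of_bound (by have := hψ.continuous; fun_prop) (|ψ x| + L * ρ.rOut) ?_
      filter_upwards [ae_norm_le_bumpMeasure ρ] with w hw
      have h1 := hψ.dist_le_mul (x + w) x
      rw [dist_eq_norm, dist_eq_norm, add_sub_cancel_left] at h1
      have h2 : ‖ψ (x + w)‖ ≤ ‖ψ x‖ + ‖ψ (x + w) - ψ x‖ := by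
        simpa using norm_add_le (ψ x) (ψ (x + w) - ψ x)
      have h3 : (L : ℝ) * ‖w‖ ≤ L * ρ.rOut := by gcongr
      rw [← Real.norm_eq_abs]
      linarith
    rw [dist_eq_norm, hG, avg, avg, ← integral_sub (hi x) (hi y)]
    have := norm_integral_le_of_norm_le_const (μ := bumpMeasure ρ) (C := L * dist x y)
      (f := fun w => ψ (x + w) - ψ (y + w)) (Filter.Eventually.of_forall fun w => by
        have := hψ.dist_le_mul (x + w) (y + w)
        rwa [dist_add_right, dist_eq_norm] at this)
    simpa using this
  -- The derivative falls on the bump `r`, so increments of `D` only involve increments of `ψ`; the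
  -- constant depends on `L` and the bump, not on `ψ`.
  have hDL : ∀ x y, ‖D x - D y‖ ≤ C * ‖x - y‖ := fun x y => by
    have hi : ∀ x, Integrable (fun t => ((ContinuousLinearMap.lsmul ℝ ℝ).precompR E)
        (ψ (x - t)) (fderiv ℝ r t)) μ := fun x =>
      ((hrc.fderiv ℝ).convolutionExists_right
        ((ContinuousLinearMap.lsmul ℝ ℝ : ℝ →L[ℝ] ℝ →L[ℝ] ℝ).precompR E)
        hψ.continuous.locallyIntegrable hdr x).integrable_swap
    rw [hD, convolution_eq_swap, convolution_eq_swap, ← integral_sub (hi x) (hi y)]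
    refine (norm_integral_le_of_norm_le ((hdi.norm.const_mul (L * ‖x - y‖)))
      (Filter.Eventually.of_forall fun t => ?_)).trans (le_of_eq ?_)
    · have e : ((ContinuousLinearMap.lsmul ℝ ℝ).precompR E) (ψ (x - t)) (fderiv ℝ r t)
          - ((ContinuousLinearMap.lsmul ℝ ℝ).precompR E) (ψ (y - t)) (fderiv ℝ r t)
          = (ψ (x - t) - ψ (y - t)) • fderiv ℝ r t := by
        ext v
        simp [ContinuousLinearMap.precompR_apply, sub_mul]
      rw [e, norm_smul]
      have := hψ.dist_le_mul (x - t) (y - t)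
      rw [dist_sub_right, dist_eq_norm, dist_eq_norm] at this
      gcongr
    · rw [integral_const_mul, hC]; ring
  have hbd : ∀ x, ‖D x‖ ≤ L := fun x => (hder x).le_of_lipschitz hGL
  have hDc : Continuous D := by
    refine (LipschitzWith.of_dist_le_mul (K := C.toNNReal) fun x y => ?_).continuous
    rw [dist_eq_norm, dist_eq_norm]
    exact (hDL x y).trans (mul_le_mul_of_nonneg_right (Real.le_coe_toNNReal C) (norm_nonneg _))
  refine ⟨fun x => (InnerProductSpace.toDual ℝ E).symm (D x), ?_, fun x => ?_, fun x w => ?_⟩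
  · exact ((InnerProductSpace.toDual ℝ E).symm.continuous.comp hDc).measurable
  · rw [LinearIsometryEquiv.norm_map]; exact hbd x
  · rw [InnerProductSpace.toDual_symm_apply]
    have hC0 : 0 ≤ C := by positivity
    have := (convex_closedBall x ‖w‖).norm_image_sub_le_of_norm_hasFDerivWithin_le' (f := G)
      (f' := D) (φ := D x) (C := C * ‖w‖) (x := x) (y := x + w)
      (fun y _ => (hder y).hasFDerivWithinAt) (fun y hy => by
        rw [Metric.mem_closedBall, dist_eq_norm] at hy
        exact (hDL y x).trans (mul_le_mul_of_nonneg_left hy hC0))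
      (Metric.mem_closedBall_self (norm_nonneg _)) (by simp)
    rw [add_sub_cancel_left] at this
    rw [← Real.norm_eq_abs]
    exact this.trans (le_of_eq (by ring))

/-- One `C` serves all parameters because the mollification bound depends only on `ρ` and the common
Lipschitz constant. -/
theorem exists_hasUniformExpansion {B : ℝ → E → ℝ} {L : NNReal}
    (ρ : ContDiffBump (0 : E)) (hB : ∀ τ : ℝ, 0 ≤ τ → LipschitzWith L (B τ)) :
    ∃ (b : ℝ → E → E) (C : ℝ), HasUniformExpansion (fun τ => avg (bumpMeasure ρ) (B τ)) b C := by
  obtain ⟨C, hC⟩ := exists_expansion_avg_bumpMeasure ρ (L := L)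
  have : ∀ τ : ℝ, ∃ b : E → E, 0 ≤ τ → Measurable b ∧ (∀ x, ‖b x‖ ≤ L) ∧
      ∀ x w, |avg (bumpMeasure ρ) (B τ) (x + w) - avg (bumpMeasure ρ) (B τ) x - ⟪b x, w⟫|
        ≤ C * ‖w‖ ^ 2 := fun τ => by
    by_cases hτ : 0 ≤ τ
    · obtain ⟨b, hb⟩ := hC (B τ) (hB τ hτ)
      exact ⟨b, fun _ => hb⟩
    · exact ⟨0, fun h => absurd h hτ⟩
  choose b hb using this
  exact ⟨b, C, fun τ hτ => (hb τ hτ).1, ⟨L, fun τ hτ => (hb τ hτ).2.1⟩, fun τ hτ => (hb τ hτ).2.2⟩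

namespace IsRegularFamily

variable {Φ B : ℝ → E → ℝ} {η : ℝ}

/-- The bump is even, so `w` can be paired with `-w`. Midpoint convexity and smoothness at `x` then
give the two comparisons that follow. -/
theorem integrable_and_avg_bumpMeasure_eq (h : IsRegularFamily Φ B η) (ρ : ContDiffBump (0 : E))
    {τ : ℝ} (hτ : 0 ≤ τ) (x : E) :
    Integrable (fun w => 1 / 2 * Φ τ (x + w) + 1 / 2 * Φ τ (x + -w)) (bumpMeasure ρ) ∧
      avg (bumpMeasure ρ) (Φ τ) x
        = ∫ w, (1 / 2 * Φ τ (x + w) + 1 / 2 * Φ τ (x + -w)) ∂(bumpMeasure ρ) := by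
  have hi := h.integrable_fun (integrable_norm_sq_bumpMeasure ρ) hτ x
  have hi' : Integrable (fun w => Φ τ (x + -w)) (bumpMeasure ρ) := by
    obtain ⟨A, hA, hg⟩ := h.growth
    refine integrable_of_growth (integrable_norm_sq_bumpMeasure ρ)
      (A := 2 * A) (c := (1 + τ ^ 2) / 2 + ‖x‖ ^ 2)
      ((h.measurable τ hτ).1.comp (measurable_neg.const_add x)) fun w => ?_
    simpa using growth_add hA (fun x => (hg τ hτ x).1) x (-w)
  refine ⟨(hi.const_mul _).add (hi'.const_mul _), ?_⟩
  rw [integral_add (hi.const_mul _) (hi'.const_mul _), integral_const_mul, integral_const_mul,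
    integral_neg_bumpMeasure ρ fun w => Φ τ (x + w), avg]
  ring

theorem le_avg_bumpMeasure (h : IsRegularFamily Φ B η) (ρ : ContDiffBump (0 : E)) {τ : ℝ}
    (hτ : 0 ≤ τ) (x : E) : Φ τ x ≤ avg (bumpMeasure ρ) (Φ τ) x := by
  obtain ⟨hi, e⟩ := h.integrable_and_avg_bumpMeasure_eq ρ hτ x
  have c : Φ τ x = ∫ _w : E, Φ τ x ∂(bumpMeasure ρ) := by simp
  rw [e, c]
  refine integral_mono (integrable_const _) hi fun w => ?_
  have := h.convex τ τ hτ hτ (x + w) (x + -w) (1 / 2) (1 / 2) (by norm_num) (by norm_num)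
    (by norm_num)
  rwa [show (1 / 2 : ℝ) * τ + 1 / 2 * τ = τ by ring,
    show (1 / 2 : ℝ) • (x + w) + (1 / 2 : ℝ) • (x + -w) = x by module] at this

theorem avg_bumpMeasure_le (h : IsRegularFamily Φ B η) (ρ : ContDiffBump (0 : E)) {τ : ℝ}
    (hτ : 0 ≤ τ) (x : E) : avg (bumpMeasure ρ) (Φ τ) x ≤ Φ τ x + ρ.rOut ^ 2 / 2 := by
  obtain ⟨hi, e⟩ := h.integrable_and_avg_bumpMeasure_eq ρ hτ x
  have c : Φ τ x + ρ.rOut ^ 2 / 2 = ∫ _w : E, (Φ τ x + ρ.rOut ^ 2 / 2) ∂(bumpMeasure ρ) := by simp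
  rw [e, c]
  refine integral_mono_ae hi (integrable_const _) ?_
  filter_upwards [ae_norm_le_bumpMeasure ρ] with w hw
  have := h.smooth τ hτ (x + w) (x + -w) (1 / 2) (1 / 2) (by norm_num) (by norm_num) (by norm_num)
  rw [show (1 / 2 : ℝ) • (x + w) + (1 / 2 : ℝ) • (x + -w) = x by module,
    show x + w - (x + -w) = (2 : ℝ) • w by module, norm_smul] at this
  have h2 : ‖w‖ ^ 2 ≤ ρ.rOut ^ 2 := by gcongr
  norm_num at this ⊢
  nlinarith

end IsRegularFamily

end Mollifier

/-! ### Projection onto closed convex sets. -/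

section Projection

variable {E : Type*} [NormedAddCommGroup E] [InnerProductSpace ℝ E] [FiniteDimensional ℝ E]

theorem infDist_eq_norm_sub_proj {K : Set E} (hK : IsClosed K) (hne : K.Nonempty) (x : E) :
    Metric.infDist x K = ‖x - proj K x‖ := by
  refine le_antisymm ?_ ((Metric.le_infDist hne).2 fun {z} hz => ?_)
  · rw [← dist_eq_norm]
    exact Metric.infDist_le_dist_of_mem (proj_mem hK hne x)
  · rw [dist_eq_norm]
    exact norm_sub_proj_le hK hne x z hz

theorem inner_sub_proj_le {K : Set E} (hK : IsClosed K) (hc : Convex ℝ K) {z : E} (hz : z ∈ K)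
    (x : E) : ⟪x - proj K x, z - proj K x⟫ ≤ 0 := by
  have hne : K.Nonempty := ⟨z, hz⟩
  have hp := proj_mem hK hne x
  refine (norm_eq_iInf_iff_real_inner_le_zero hc hp).1 ?_ z hz
  have : Nonempty K := ⟨⟨z, hz⟩⟩
  refine le_antisymm (le_ciInf fun w => norm_sub_proj_le hK hne x w w.2) ?_
  exact ciInf_le ⟨0, by rintro _ ⟨w, rfl⟩; exact norm_nonneg _⟩ (⟨_, hp⟩ : K)

theorem norm_proj_sub_proj_le {K : Set E} (hK : IsClosed K) (hc : Convex ℝ K) (hne : K.Nonempty)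
    (x y : E) : ‖proj K x - proj K y‖ ≤ ‖x - y‖ := by
  have h1 := inner_sub_proj_le hK hc (proj_mem hK hne y) x
  have h2 := inner_sub_proj_le hK hc (proj_mem hK hne x) y
  have h3 : ‖proj K x - proj K y‖ ^ 2 ≤ ⟪x - y, proj K x - proj K y⟫ := by
    have e : ⟪x - y, proj K x - proj K y⟫ = ‖proj K x - proj K y‖ ^ 2
        - ⟪x - proj K x, proj K y - proj K x⟫ - ⟪y - proj K y, proj K x - proj K y⟫ := by
      rw [← real_inner_self_eq_norm_sq]
      simp only [inner_sub_left, inner_sub_right]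
      ring
    linarith
  have h4 := real_inner_le_norm (x - y) (proj K x - proj K y)
  by_contra! hlt
  have h5 : 0 < ‖proj K x - proj K y‖ := (norm_nonneg _).trans_lt hlt
  nlinarith

theorem continuous_proj {K : Set E} (hK : IsClosed K) (hc : Convex ℝ K) (hne : K.Nonempty) :
    Continuous (proj K) :=
  (LipschitzWith.of_dist_le_mul (K := 1) fun x y => by
    simpa [dist_eq_norm] using norm_proj_sub_proj_le hK hc hne x y).continuous

end Projection

/-! ### Support functions of compact sets. -/

section Support

variable {E : Type*} [NormedAddCommGroup E] [InnerProductSpace ℝ E]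

/-- The support function of a set. -/
noncomputable def supportFn (S : Set E) (u : E) : ℝ := sSup ((fun s => ⟪s, u⟫) '' S)

theorem bddAbove_inner {S : Set E} (hS : IsCompact S) (u : E) :
    BddAbove ((fun s => ⟪s, u⟫) '' S) := (hS.image (by fun_prop)).bddAbove

theorem inner_le_supportFn {S : Set E} (hS : IsCompact S) {s : E} (hs : s ∈ S) (u : E) :
    ⟪s, u⟫ ≤ supportFn S u := le_csSup (bddAbove_inner hS u) ⟨s, hs, rfl⟩

theorem exists_inner_eq_supportFn {S : Set E} (hS : IsCompact S) (hne : S.Nonempty) (u : E) :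
    ∃ s ∈ S, ⟪s, u⟫ = supportFn S u :=
  (hS.image (f := fun s => ⟪s, u⟫) (by fun_prop)).sSup_mem (hne.image _)

theorem supportFn_sub_le {S : Set E} (hS : IsCompact S) (hne : S.Nonempty) {R : ℝ}
    (hR : ∀ s ∈ S, ‖s‖ ≤ R) (u v : E) : |supportFn S u - supportFn S v| ≤ R * ‖u - v‖ := by
  have key : ∀ u v : E, supportFn S u - supportFn S v ≤ R * ‖u - v‖ := fun u v => by
    obtain ⟨s, hs, he⟩ := exists_inner_eq_supportFn hS hne u
    have h1 := inner_le_supportFn hS hs v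
    have h2 := real_inner_le_norm s (u - v)
    rw [inner_sub_right] at h2
    have h3 : ‖s‖ * ‖u - v‖ ≤ R * ‖u - v‖ := by gcongr; exact hR s hs
    linarith
  rw [abs_le]
  refine ⟨?_, key u v⟩
  have := key v u
  rw [norm_sub_rev] at this
  linarith

end Support

/-! ### Squared distances to dilates of a compact convex set. -/

section DistFamily

variable {E : Type*} [NormedAddCommGroup E] [InnerProductSpace ℝ E] [FiniteDimensional ℝ E]

/-- Half the squared distance to `τ • S`, with the strongly convex term `η / 2 * τ ^ 2`. -/
noncomputable def distFamily (S : Set E) (η τ : ℝ) (x : E) : ℝ :=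
  Metric.infDist x (τ • S) ^ 2 / 2 + η / 2 * τ ^ 2

/-- The derivative of `distFamily S η` in the parameter. -/
noncomputable def distFamilyDeriv (S : Set E) (η τ : ℝ) (x : E) : ℝ :=
  -supportFn S (x - proj (τ • S) x) + η * τ

variable {S : Set E}

theorem exists_proj_smul_eq (hS : IsCompact S) (hne : S.Nonempty) (τ : ℝ) (x : E) :
    ∃ s ∈ S, τ • s = proj (τ • S) x :=
  proj_mem (hS.smul τ).isClosed (hne.smul_set) x

theorem distFamily_eq (hS : IsCompact S) (hne : S.Nonempty) (η τ : ℝ) (x : E) :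
    distFamily S η τ x = ‖x - proj (τ • S) x‖ ^ 2 / 2 + η / 2 * τ ^ 2 := by
  rw [distFamily, infDist_eq_norm_sub_proj (hS.smul τ).isClosed hne.smul_set]

theorem distFamily_le (hS : IsCompact S) (hne : S.Nonempty) (η τ : ℝ) (x : E) {s : E}
    (hs : s ∈ S) : distFamily S η τ x ≤ ‖x - τ • s‖ ^ 2 / 2 + η / 2 * τ ^ 2 := by
  rw [distFamily_eq hS hne]
  have := norm_sub_proj_le (hS.smul τ).isClosed hne.smul_set x (τ • s) (Set.smul_mem_smul_set hs)
  gcongr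

/-- The variational inequality of the projection says that the projected point maximizes the pairing
with the residual over `τ • S`. -/
theorem mul_supportFn_eq (hS : IsCompact S) (hc : Convex ℝ S) (hne : S.Nonempty) {τ : ℝ}
    (hτ : 0 ≤ τ) (x : E) :
    τ * supportFn S (x - proj (τ • S) x) = ⟪proj (τ • S) x, x - proj (τ • S) x⟫ := by
  set u := x - proj (τ • S) x with hu
  obtain ⟨s, hs, he⟩ := exists_proj_smul_eq hS hne τ x
  obtain ⟨t, ht, he'⟩ := exists_inner_eq_supportFn hS hne u
  have h1 := inner_sub_proj_le (hS.smul τ).isClosed (hc.smul τ) (Set.smul_mem_smul_set ht) x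
  rw [← hu, inner_sub_right, inner_smul_right, real_inner_comm, he', real_inner_comm] at h1
  have h2 := mul_le_mul_of_nonneg_left (inner_le_supportFn hS hs u) hτ
  rw [← real_inner_smul_left, he] at h2
  linarith

/-- Testing each projection's variational inequality with the rescaled point of the other and adding
leaves a term proportional to `σ - τ`. The resulting Hölder bound suffices for continuity in the
parameter. -/
theorem norm_proj_smul_sub_sq_le (hS : IsCompact S) (hc : Convex ℝ S) (hne : S.Nonempty) {R : ℝ}
    (hR : ∀ s ∈ S, ‖s‖ ≤ R) (τ σ : ℝ) (x : E) :
    ‖proj (τ • S) x - proj (σ • S) x‖ ^ 2 ≤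
      |σ - τ| * (R * (2 * ‖x‖ + (|τ| + |σ|) * R)) := by
  obtain ⟨s, hs, he⟩ := exists_proj_smul_eq hS hne τ x
  obtain ⟨t, ht, he'⟩ := exists_proj_smul_eq hS hne σ x
  have h1 := inner_sub_proj_le (hS.smul τ).isClosed (hc.smul τ) (Set.smul_mem_smul_set ht) x
  have h2 := inner_sub_proj_le (hS.smul σ).isClosed (hc.smul σ) (Set.smul_mem_smul_set hs) x
  rw [← he] at h1 ⊢
  rw [← he'] at h2 ⊢
  have hb : ∀ (a : ℝ) (s t : E), s ∈ S → t ∈ S → |⟪x - a • s, t⟫| ≤ R * (‖x‖ + |a| * R) := by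
    intro a s t hs ht
    have hR0 : 0 ≤ R := (norm_nonneg _).trans (hR s hs)
    refine (abs_real_inner_le_norm _ _).trans ?_
    rw [mul_comm]
    have : ‖x - a • s‖ ≤ ‖x‖ + |a| * R := (norm_sub_le _ _).trans (by
      rw [norm_smul, Real.norm_eq_abs]
      gcongr
      exact hR s hs)
    exact mul_le_mul (hR t ht) this (norm_nonneg _) hR0
  have e : ‖τ • s - σ • t‖ ^ 2 = ⟪x - τ • s, τ • t - τ • s⟫ + ⟪x - σ • t, σ • s - σ • t⟫
      + (σ - τ) * (⟪x - τ • s, t⟫ - ⟪x - σ • t, s⟫) := by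
    rw [← real_inner_self_eq_norm_sq]
    simp only [inner_sub_left, inner_sub_right, inner_smul_left, inner_smul_right,
      RCLike.conj_to_real, real_inner_comm s t]
    ring
  have h3 : (σ - τ) * (⟪x - τ • s, t⟫ - ⟪x - σ • t, s⟫)
      ≤ |σ - τ| * (R * (2 * ‖x‖ + (|τ| + |σ|) * R)) := by
    refine (le_abs_self _).trans ?_
    rw [abs_mul]
    refine mul_le_mul_of_nonneg_left ((abs_sub _ _).trans ?_) (abs_nonneg _)
    have := hb τ s t hs ht
    have := hb σ t s ht hs
    linarith
  linarith

theorem continuous_proj_smul (hS : IsCompact S) (hc : Convex ℝ S) (hne : S.Nonempty) (x : E) :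
    Continuous fun τ : ℝ => proj (τ • S) x := by
  obtain ⟨R, hR⟩ := hS.isBounded.exists_norm_le
  rw [continuous_iff_continuousAt]
  intro τ
  rw [ContinuousAt, tendsto_iff_norm_sub_tendsto_zero]
  have hlim : Filter.Tendsto
      (fun σ : ℝ => √(|τ - σ| * (R * (2 * ‖x‖ + (|σ| + |τ|) * R)))) (nhds τ) (nhds 0) := by
    have hcont : Continuous
        fun σ : ℝ => √(|τ - σ| * (R * (2 * ‖x‖ + (|σ| + |τ|) * R))) := by fun_prop
    simpa using hcont.tendsto τ
  refine squeeze_zero (fun _ => norm_nonneg _) (fun σ => ?_) hlim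
  exact Real.le_sqrt_of_sq_le (norm_proj_smul_sub_sq_le hS hc hne hR σ τ x)

theorem lipschitzWith_distFamilyDeriv (hS : IsCompact S) (hc : Convex ℝ S) (hne : S.Nonempty)
    {R : NNReal} (hR : ∀ s ∈ S, ‖s‖ ≤ R) (η τ : ℝ) :
    LipschitzWith (2 * R) (distFamilyDeriv S η τ) := by
  refine LipschitzWith.of_dist_le_mul fun x y => ?_
  rw [dist_eq_norm, dist_eq_norm, Real.norm_eq_abs, distFamilyDeriv, distFamilyDeriv,
    add_sub_add_right_eq_sub, neg_sub_neg, abs_sub_comm]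
  refine (supportFn_sub_le hS hne hR _ _).trans ?_
  have h1 := norm_proj_sub_proj_le (hS.smul τ).isClosed (hc.smul τ) hne.smul_set x y
  have h2 : ‖x - proj (τ • S) x - (y - proj (τ • S) y)‖ ≤ 2 * ‖x - y‖ := by
    rw [sub_sub_sub_comm]
    refine (norm_sub_le _ _).trans ?_
    linarith
  push_cast
  nlinarith [R.coe_nonneg]

/-- Joint convexity comes from convexity of the pairs `(τ, z)` with `τ ≥ 0`, `z ∈ τ • S`. Smoothness
holds because the distance is an infimum of paraboloids: the nearest point for the combination is
used as a competitor for `x` and `y`. The inequality in `τ` results from expanding the square around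
the projection and dropping a square. -/
theorem isRegularFamily_distFamily [MeasurableSpace E] [BorelSpace E] (hS : IsCompact S)
    (hc : Convex ℝ S) (hne : S.Nonempty) {η : ℝ} (hη : 0 ≤ η) :
    IsRegularFamily (distFamily S η) (distFamilyDeriv S η) η where
  convex τ σ hτ hσ x y a b ha hb hab := by
    obtain ⟨s, hs, he⟩ := exists_proj_smul_eq hS hne τ x
    obtain ⟨t, ht, he'⟩ := exists_proj_smul_eq hS hne σ y
    rw [distFamily_eq hS hne η τ x, distFamily_eq hS hne η σ y, ← he, ← he']
    obtain ⟨r, hr, hre⟩ : ∃ r ∈ S, (a * τ + b * σ) • r = a • τ • s + b • σ • t := by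
      -- If the combined parameter is zero, both weighted dilations vanish and the normalized convex
      -- combination below is undefined; any element of `S` will do.
      by_cases h0 : a * τ + b * σ = 0
      · have h1 : 0 ≤ a * τ := by positivity
        have h2 : 0 ≤ b * σ := by positivity
        refine ⟨s, hs, ?_⟩
        rw [smul_smul, smul_smul, h0, show a * τ = 0 by linarith, show b * σ = 0 by linarith]
        simp
      · refine ⟨(a * τ / (a * τ + b * σ)) • s + (b * σ / (a * τ + b * σ)) • t,
          hc hs ht (by positivity) (by positivity) (by field_simp), ?_⟩
        rw [smul_add, smul_smul, smul_smul, smul_smul, smul_smul, mul_div_cancel₀ _ h0,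
          mul_div_cancel₀ _ h0]
    refine (distFamily_le hS hne η _ _ hr).trans ?_
    rw [hre, show a • x + b • y - (a • τ • s + b • σ • t)
      = a • (x - τ • s) + b • (y - σ • t) by module]
    set p := x - τ • s
    set q := y - σ • t
    have hb' : b = 1 - a := by linarith
    have h1 : ‖a • p + b • q‖ ≤ a * ‖p‖ + b * ‖q‖ := by
      refine (norm_add_le _ _).trans (le_of_eq ?_)
      rw [norm_smul, norm_smul, Real.norm_of_nonneg ha, Real.norm_of_nonneg hb]
    have h2 : ‖a • p + b • q‖ ^ 2 ≤ (a * ‖p‖ + b * ‖q‖) ^ 2 := by gcongr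
    have h3 : (a * ‖p‖ + b * ‖q‖) ^ 2 = a * ‖p‖ ^ 2 + b * ‖q‖ ^ 2 - a * b * (‖p‖ - ‖q‖) ^ 2 := by
      rw [hb']; ring
    have h4 : (a * τ + b * σ) ^ 2 = a * τ ^ 2 + b * σ ^ 2 - a * b * (τ - σ) ^ 2 := by
      rw [hb']; ring
    have h5 : 0 ≤ a * b * (‖p‖ - ‖q‖) ^ 2 := by positivity
    have h6 : 0 ≤ η * (a * b * (τ - σ) ^ 2) := by positivity
    rw [h4]
    nlinarith
  smooth τ hτ x y a b ha hb hab := by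
    obtain ⟨s, hs, he⟩ := exists_proj_smul_eq hS hne τ (a • x + b • y)
    rw [distFamily_eq hS hne η τ (a • x + b • y), ← he]
    have h1 := mul_le_mul_of_nonneg_left (distFamily_le hS hne η τ x hs) ha
    have h2 := mul_le_mul_of_nonneg_left (distFamily_le hS hne η τ y hs) hb
    have hb' : b = 1 - a := by linarith
    have e : ‖a • x + b • y - τ • s‖ ^ 2
        = a * ‖x - τ • s‖ ^ 2 + b * ‖y - τ • s‖ ^ 2 - a * b * ‖x - y‖ ^ 2 := by
      rw [show a • x + b • y - τ • s = a • (x - τ • s) + b • (y - τ • s) by rw [hb']; module,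
        show x - y = (x - τ • s) - (y - τ • s) by abel, norm_add_sq_real,
        norm_sub_sq_real (x - τ • s), norm_smul, norm_smul, real_inner_smul_left, real_inner_smul_right, mul_pow, mul_pow,
        Real.norm_eq_abs, Real.norm_eq_abs, sq_abs, sq_abs, hb']
      ring
    rw [e]
    have h3 : a * (η / 2 * τ ^ 2) + b * (η / 2 * τ ^ 2) = η / 2 * τ ^ 2 := by
      rw [← add_mul, hab, one_mul]
    linarith
  subgradient τ σ hτ hσ x := by
    rw [distFamily_eq hS hne η τ x, distFamily_eq hS hne η σ x, distFamilyDeriv]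
    obtain ⟨t, ht, he⟩ := exists_proj_smul_eq hS hne σ x
    rw [← he]
    have h1 := mul_supportFn_eq hS hc hne hτ x
    have h2 := mul_le_mul_of_nonneg_left (inner_le_supportFn hS ht (x - proj (τ • S) x)) hσ
    set p := proj (τ • S) x
    set h := supportFn S (x - p)
    rw [← real_inner_smul_left] at h2
    have h3 : ‖x - σ • t‖ ^ 2 = ‖x - p‖ ^ 2 + 2 * (⟪p, x - p⟫ - ⟪σ • t, x - p⟫)
        + ‖p - σ • t‖ ^ 2 := by
      rw [show x - σ • t = (x - p) + (p - σ • t) by abel, norm_add_sq_real, inner_sub_right,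
        real_inner_comm p, real_inner_comm (σ • t)]
    rw [h3]
    nlinarith [sq_nonneg ‖p - σ • t‖]
  continuousOn x := by
    obtain ⟨R, hR⟩ := hS.isBounded.exists_norm_le
    have h1 : Continuous (supportFn S) := by
      refine (LipschitzWith.of_dist_le_mul (K := R.toNNReal) fun u v => ?_).continuous
      rw [dist_eq_norm, dist_eq_norm]
      exact (supportFn_sub_le hS hne hR u v).trans
        (mul_le_mul_of_nonneg_right (Real.le_coe_toNNReal R) (norm_nonneg _))
    have h2 := continuous_proj_smul hS hc hne x
    exact ((h1.comp (continuous_const.sub h2)).neg.add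
      (continuous_const.mul continuous_id)).continuousOn
  measurable τ hτ := by
    obtain ⟨R, hR⟩ := hS.isBounded.exists_norm_le
    refine ⟨?_, (lipschitzWith_distFamilyDeriv hS hc hne (R := R.toNNReal)
      (fun s hs => (hR s hs).trans (Real.le_coe_toNNReal R)) η τ).continuous.measurable⟩
    have : Continuous fun x => Metric.infDist x (τ • S) := Metric.continuous_infDist_pt _
    unfold distFamily
    fun_prop
  growth := by
    obtain ⟨R, hR⟩ := hS.isBounded.exists_norm_le
    obtain ⟨s, hs⟩ := hne
    have hR0 : 0 ≤ R := (norm_nonneg _).trans (hR s hs)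
    refine ⟨(1 + R) ^ 2 + η, by positivity, fun τ hτ x => ?_⟩
    obtain ⟨t, ht, he⟩ := exists_proj_smul_eq hS ⟨s, hs⟩ τ x
    have h1 : ‖x - τ • t‖ ≤ ‖x‖ + τ * R := (norm_sub_le _ _).trans (by
      rw [norm_smul, Real.norm_of_nonneg hτ]
      gcongr
      exact hR t ht)
    have h2 : ‖x - τ • t‖ ^ 2 ≤ (‖x‖ + τ * R) ^ 2 := by gcongr
    have hx := norm_nonneg x
    constructor
    · rw [distFamily_eq hS ⟨s, hs⟩, ← he, abs_of_nonneg (by positivity)]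
      nlinarith [sq_nonneg (‖x‖ - τ * R), mul_nonneg hR0 (sq_nonneg ‖x‖), sq_nonneg τ,
        mul_nonneg hR0 (sq_nonneg τ), mul_nonneg (sq_nonneg R) (sq_nonneg ‖x‖),
        mul_nonneg hη (sq_nonneg ‖x‖), mul_nonneg hη (sq_nonneg τ), sq_nonneg ‖x‖]
    · rw [distFamilyDeriv, ← he]
      obtain ⟨r, hr, hre⟩ := exists_inner_eq_supportFn hS ⟨s, hs⟩ (x - τ • t)
      rw [← hre]
      have h3 : |⟪r, x - τ • t⟫| ≤ R * (‖x‖ + τ * R) :=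
        (abs_real_inner_le_norm _ _).trans (mul_le_mul (hR r hr) h1 (norm_nonneg _) hR0)
      have h4 : |-⟪r, x - τ • t⟫ + η * τ| ≤ R * (‖x‖ + τ * R) + η * τ := by
        refine (abs_add_le _ _).trans ?_
        rw [abs_neg, abs_of_nonneg (by positivity : 0 ≤ η * τ)]
        linarith
      refine h4.trans ?_
      nlinarith [sq_nonneg (‖x‖ - 1), sq_nonneg (τ - 1), mul_nonneg hR0 (sq_nonneg (‖x‖ - 1)),
        mul_nonneg (sq_nonneg R) (sq_nonneg (τ - 1)), mul_nonneg hη (sq_nonneg (τ - 1)),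
        mul_nonneg hη (sq_nonneg ‖x‖), mul_nonneg hR0 (sq_nonneg τ),
        mul_nonneg (sq_nonneg R) (sq_nonneg ‖x‖), mul_nonneg hR0 (sq_nonneg ‖x‖)]

variable [MeasurableSpace E] [BorelSpace E]

theorem integrable_infDist_sq (hS : IsCompact S) (hc : Convex ℝ S) (hne : S.Nonempty) {τ : ℝ}
    (hτ : 0 ≤ τ) : Integrable (fun g => Metric.infDist g (τ • S) ^ 2) (stdGaussian E) := by
  have h := (isRegularFamily_distFamily hS hc hne le_rfl).integrable_fun
    (integrable_norm_pow_stdGaussian 2) hτ (0 : E)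
  refine (h.const_mul 2).congr (Filter.Eventually.of_forall fun w => ?_)
  simp only [distFamily, zero_add]
  ring

/-- The expected squared distance to the cone generated by `S` is, up to the additive constant `2`,
the smallest expected squared distance to a multiple of `S`. -/
theorem iInf_expSqDist_le (hS : IsCompact S) (hc : Convex ℝ S) (hne : S.Nonempty)
    (h0 : (0 : E) ∉ S) {v : E → ℝ} (hv : Measurable v) (hvg : ∀ x, v x ≤ ‖x‖ ^ 2)
    (hle : ∀ x, ∃ τ : ℝ, 0 ≤ τ ∧ Metric.infDist x (τ • S) ^ 2 ≤ v x) :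
    (⨅ τ : Set.Ici (0 : ℝ), expSqDist S τ) ≤ ∫ g, v g ∂(stdGaussian E) + 2 := by
  obtain ⟨R, hR⟩ := hS.isBounded.exists_norm_le
  obtain ⟨r, hr, hrS⟩ : ∃ r : ℝ, 0 < r ∧ ∀ s ∈ S, r ≤ ‖s‖ := by
    obtain ⟨s, hs, hmin⟩ := hS.exists_isMinOn hne continuous_norm.continuousOn
    exact ⟨‖s‖, norm_pos_iff.2 fun h => h0 (h ▸ hs), fun t ht => hmin ht⟩
  have hv0 : ∀ x, 0 ≤ v x := fun x => by
    obtain ⟨τ, -, h⟩ := hle x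
    exact (sq_nonneg _).trans h
  have hvi : Integrable v (stdGaussian E) :=
    integrable_of_growth (integrable_norm_pow_stdGaussian 2) hv (A := 1) (c := 0) fun x => by
      rw [abs_of_nonneg (hv0 x)]; linarith [hvg x]
  set m := ∫ w, ‖w‖ ^ 2 ∂(stdGaussian E) with hm
  have hm0 : 0 ≤ m := integral_nonneg fun w => by positivity
  refine le_of_forall_pos_le_add fun δ hδ => ?_
  -- Chosen so that the regularization costs at most `δ / 8` on average, where `r` is a lower bound
  -- of the norm on `S`; `κ` makes the mollification cost `δ / 8` too.
  set η := δ * r ^ 2 / (16 * (m + 1)) with hη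
  have hηpos : 0 < η := by positivity
  set κ := √(δ / 4) with hκ
  have hκpos : 0 < κ := Real.sqrt_pos.2 (by positivity)
  set ρ : ContDiffBump (0 : E) := ⟨κ / 2, κ, by positivity, by linarith⟩ with hρ
  have hreg := isRegularFamily_distFamily hS hc hne hηpos.le
  obtain ⟨b, C, hb⟩ := exists_hasUniformExpansion ρ fun τ _ =>
    lipschitzWith_distFamilyDeriv hS hc hne (R := R.toNNReal)
      (fun s hs => (hR s hs).trans (Real.le_coe_toNNReal R)) η τ
  set u : E → ℝ := fun x => v x / 2 + (2 * η / r ^ 2 * ‖x‖ ^ 2 + κ ^ 2 / 2) with hu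
  have hu0 : ∀ x, 0 ≤ u x := fun x => by have := hv0 x; positivity
  have hle' : ∀ y, ∃ τ : ℝ, 0 ≤ τ ∧ avg (bumpMeasure ρ) (distFamily S η τ) y ≤ u y := fun y => by
    obtain ⟨τ, hτ, h⟩ := hle y
    refine ⟨τ, hτ, (hreg.avg_bumpMeasure_le ρ hτ y).trans ?_⟩
    obtain ⟨s, hs, he⟩ := exists_proj_smul_eq hS hne τ y
    have hd := h.trans (hvg y)
    rw [infDist_eq_norm_sub_proj (hS.smul τ).isClosed hne.smul_set, ← he] at hd
    have hd' : ‖y - τ • s‖ ≤ ‖y‖ := (sq_le_sq₀ (norm_nonneg _) (norm_nonneg _)).1 hd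
    -- A parameter whose distance is at most `‖y‖` cannot be large, because `S` stays away from the
    -- origin. This controls the added term `η / 2 * τ ^ 2`.
    have h1 : τ * r ≤ 2 * ‖y‖ := by
      have h2 : ‖τ • s‖ ≤ ‖y‖ + ‖y - τ • s‖ := by
        simpa using norm_sub_le y (y - τ • s)
      rw [norm_smul, Real.norm_of_nonneg hτ] at h2
      have := mul_le_mul_of_nonneg_left (hrS s hs) hτ
      linarith
    have h3 : τ ^ 2 ≤ 4 * ‖y‖ ^ 2 / r ^ 2 := by
      rw [le_div_iff₀ (by positivity), ← mul_pow]
      have : (τ * r) ^ 2 ≤ (2 * ‖y‖) ^ 2 := by gcongr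
      linarith
    have h4 : η / 2 * τ ^ 2 ≤ 2 * η / r ^ 2 * ‖y‖ ^ 2 := by
      refine (mul_le_mul_of_nonneg_left h3 (by positivity)).trans (le_of_eq ?_)
      field_simp
      norm_num
    simp only [hu, distFamily]
    linarith
  obtain ⟨τ, hτ, hi⟩ := (hreg.average (integrable_norm_sq_bumpMeasure ρ)).exists_integral_le hηpos
    hb (u := u) (by fun_prop) (A := 1 / 2 + 2 * η / r ^ 2 + κ ^ 2 / 2) (by positivity) (fun x => by
      rw [abs_of_nonneg (hu0 x)]
      have h1 := hvg x
      have h2 : 0 ≤ κ ^ 2 / 2 * ‖x‖ ^ 2 := by positivity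
      have h3 : 0 ≤ 2 * η / r ^ 2 := by positivity
      simp only [hu]
      nlinarith) hle' (half_pos (half_pos (half_pos hδ)))
  have hbdd : BddBelow (Set.range fun τ : Set.Ici (0 : ℝ) => expSqDist S τ) :=
    ⟨0, by rintro _ ⟨τ, rfl⟩; exact integral_nonneg fun _ => sq_nonneg _⟩
  refine (ciInf_le hbdd ⟨τ, hτ⟩).trans ?_
  -- Mollifying a convex function and adding a nonnegative term only increase it, so both
  -- modifications can be discarded on this side.
  have h1 : expSqDist S τ ≤ 2 * ∫ x, avg (bumpMeasure ρ) (distFamily S η τ) x ∂(stdGaussian E) := by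
    rw [expSqDist, ← integral_const_mul]
    have hi' := (hreg.average (integrable_norm_sq_bumpMeasure ρ)).integrable_fun
      (integrable_norm_pow_stdGaussian 2) hτ (0 : E)
    simp only [zero_add] at hi'
    refine integral_mono (integrable_infDist_sq hS hc hne hτ) (hi'.const_mul 2) fun x => ?_
    have h2 := hreg.le_avg_bumpMeasure ρ hτ x
    have h3 : Metric.infDist x (τ • S) ^ 2 / 2 ≤ distFamily S η τ x := by
      rw [distFamily]
      have : 0 ≤ η / 2 * τ ^ 2 := by positivity
      linarith
    simp only
    linarith
  have h2 : ∫ x, u x ∂(stdGaussian E)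
      = (∫ g, v g ∂(stdGaussian E)) / 2 + (2 * η / r ^ 2 * m + κ ^ 2 / 2) := by
    have hn := (integrable_norm_pow_stdGaussian (E := E) 2).const_mul (2 * η / r ^ 2)
    have hn' : Integrable (fun x : E => 2 * η / r ^ 2 * ‖x‖ ^ 2 + κ ^ 2 / 2) (stdGaussian E) :=
      hn.add (integrable_const _)
    rw [hu, integral_add (hvi.div_const 2) hn', integral_add hn (integrable_const _),
      integral_div, integral_const_mul]
    simp [hm]
  have h3 : κ ^ 2 = δ / 4 := Real.sq_sqrt (by positivity)
  have h4 : 2 * η / r ^ 2 * m ≤ δ / 8 := by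
    have : 2 * η / r ^ 2 * m = δ / 8 * (m / (m + 1)) := by
      rw [hη]; field_simp; ring
    rw [this]
    exact mul_le_of_le_one_right (by positivity) ((div_le_one (by positivity)).2 (by linarith))
  linarith

end DistFamily

/-! ### Descent cones, subdifferentials and polarity. -/

section DescentCone

variable {E : Type*} [NormedAddCommGroup E] [InnerProductSpace ℝ E] {f : E → ℝ} {x : E}

theorem mem_descentCone {u : E} : u ∈ descentCone f x ↔ ∃ t : ℝ, 0 < t ∧ f (x + t • u) ≤ f x := by
  simp [descentCone]

theorem zero_mem_descentCone : (0 : E) ∈ descentCone f x :=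
  mem_descentCone.2 ⟨1, one_pos, by simp⟩

theorem smul_mem_descentCone {u : E} (hu : u ∈ descentCone f x) {c : ℝ} (hc : 0 < c) :
    c • u ∈ descentCone f x := by
  obtain ⟨t, ht, h⟩ := mem_descentCone.1 hu
  exact mem_descentCone.2 ⟨t / c, div_pos ht hc, by rwa [smul_smul, div_mul_cancel₀ _ hc.ne']⟩

theorem ConvexOn.add_mem_descentCone (hf : ConvexOn ℝ Set.univ f) {u v : E}
    (hu : u ∈ descentCone f x) (hv : v ∈ descentCone f x) : u + v ∈ descentCone f x := by
  obtain ⟨s, hs, h⟩ := mem_descentCone.1 hu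
  obtain ⟨t, ht, h'⟩ := mem_descentCone.1 hv
  -- With this step the new point is a convex combination of the two given descent points.
  refine mem_descentCone.2 ⟨s * t / (s + t), by positivity, ?_⟩
  have hst : s + t ≠ 0 := by positivity
  have hab : t / (s + t) + s / (s + t) = 1 := by field_simp; ring
  have key := hf.2 (Set.mem_univ (x + s • u)) (Set.mem_univ (x + t • v))
    (by positivity : 0 ≤ t / (s + t)) (by positivity : 0 ≤ s / (s + t)) hab
  have e : (t / (s + t)) • (x + s • u) + (s / (s + t)) • (x + t • v)
      = x + (s * t / (s + t)) • (u + v) := by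
    have hx : x = (t / (s + t) + s / (s + t)) • x := by rw [hab, one_smul]
    nth_rewrite 3 [hx]
    module
  rw [e] at key
  refine key.trans ?_
  have h1 := mul_le_mul_of_nonneg_left h (by positivity : 0 ≤ t / (s + t))
  have h2 := mul_le_mul_of_nonneg_left h' (by positivity : 0 ≤ s / (s + t))
  have h3 : t / (s + t) * f x + s / (s + t) * f x = f x := by rw [← add_mul, hab, one_mul]
  simp only [smul_eq_mul]
  linarith

theorem ConvexOn.add_mem_closure_descentCone (hf : ConvexOn ℝ Set.univ f) {u v : E}
    (hu : u ∈ closure (descentCone f x)) (hv : v ∈ closure (descentCone f x)) :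
    u + v ∈ closure (descentCone f x) :=
  map_mem_closure₂ continuous_add hu hv fun _ h _ h' => hf.add_mem_descentCone h h'

theorem ConvexOn.convex_closure_descentCone (hf : ConvexOn ℝ Set.univ f) :
    Convex ℝ (closure (descentCone f x)) := by
  refine Convex.closure fun u hu v hv a b ha hb _ => ?_
  rcases ha.eq_or_lt with rfl | ha
  · rcases hb.eq_or_lt with rfl | hb
    · simpa using zero_mem_descentCone
    · simpa using smul_mem_descentCone hv hb
  · rcases hb.eq_or_lt with rfl | hb
    · simpa using smul_mem_descentCone hu ha
    · exact hf.add_mem_descentCone (smul_mem_descentCone hu ha) (smul_mem_descentCone hv hb)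

theorem closure_descentCone_nonempty : (closure (descentCone f x)).Nonempty :=
  ⟨0, subset_closure zero_mem_descentCone⟩

theorem inner_le_zero_of_mem_subdiff {s u : E} (hs : s ∈ subdiff f x)
    (hu : u ∈ closure (descentCone f x)) : ⟪s, u⟫ ≤ 0 := by
  have hcl : IsClosed {u : E | ⟪s, u⟫ ≤ 0} := isClosed_le (by fun_prop) continuous_const
  refine closure_minimal (fun u hu => ?_) hcl hu
  obtain ⟨t, ht, h⟩ := mem_descentCone.1 hu
  have h1 := hs (x + t • u)
  rw [add_sub_cancel_left, inner_smul_right] at h1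
  have h2 : t * ⟪s, u⟫ ≤ 0 := by linarith
  exact nonpos_of_mul_nonpos_right h2 ht

theorem convex_subdiff : Convex ℝ (subdiff f x) := by
  intro s hs t ht a b ha hb hab y
  have h1 := mul_le_mul_of_nonneg_left (hs y) ha
  have h2 := mul_le_mul_of_nonneg_left (ht y) hb
  have h3 : b = 1 - a := by linarith
  rw [inner_add_left, real_inner_smul_left, real_inner_smul_left]
  rw [h3] at h2 ⊢
  linarith

variable [FiniteDimensional ℝ E]

/-- A direction in which all subgradients are negative is a descent direction. -/
theorem ConvexOn.mem_descentCone_of_inner_neg (hf : ConvexOn ℝ Set.univ f) (hc : Continuous f)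
    {u : E} (hu : ∀ s ∈ subdiff f x, ⟪s, u⟫ < 0) : u ∈ descentCone f x := by
  by_contra hnot
  have hlt : ∀ t : ℝ, 0 < t → f x < f (x + t • u) := fun t ht => by
    by_contra! h
    exact hnot (mem_descentCone.2 ⟨t, ht, h⟩)
  -- If `u` were not a descent direction, the strict epigraph would miss the horizontal ray from
  -- `(x, f x)` along `u`. A separating hyperplane is non-vertical and gives a subgradient with
  -- nonnegative pairing with `u`.
  set U : Set (E × ℝ) := {p | f p.1 < p.2} with hU
  set T : Set (E × ℝ) := (fun t : ℝ => (x + t • u, f x)) '' Set.Ici 0 with hT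
  have hUo : IsOpen U := isOpen_lt (by fun_prop) continuous_snd
  have hUc : Convex ℝ U := by
    have := hf.convex_strict_epigraph
    simpa [hU] using this
  have hTc : Convex ℝ T := by
    rintro _ ⟨s, hs, rfl⟩ _ ⟨t, ht, rfl⟩ a b ha hb hab
    have hs' : (0 : ℝ) ≤ s := hs
    have ht' : (0 : ℝ) ≤ t := ht
    have hb' : b = 1 - a := by linarith
    refine ⟨a * s + b * t, by simp only [Set.mem_Ici]; positivity, ?_⟩
    ext
    · simp only [Prod.fst_add, Prod.smul_fst]
      rw [hb']; module
    · simp only [Prod.snd_add, Prod.smul_snd, smul_eq_mul]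
      rw [hb']; ring
  have hdisj : Disjoint U T := by
    rw [Set.disjoint_right]
    rintro _ ⟨t, ht, rfl⟩ h
    have h' : f (x + t • u) < f x := h
    rcases (show (0 : ℝ) ≤ t from ht).eq_or_lt with rfl | ht
    · simp at h'
    · exact lt_asymm h' (hlt t ht)
  obtain ⟨ℓ, c, hℓU, hℓT⟩ := geometric_hahn_banach_open hUc hUo hTc hdisj
  set β := ℓ (0, 1) with hβ
  set g : E →L[ℝ] ℝ := ℓ.comp (ContinuousLinearMap.inl ℝ E ℝ) with hg
  have hℓ : ∀ (y : E) (a : ℝ), ℓ (y, a) = g y + β * a := fun y a => by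
    have : ((y, a) : E × ℝ) = (y, 0) + a • (0, 1) := by simp
    rw [this, map_add, map_smul, smul_eq_mul, mul_comm a]
    rfl
  have hT' : ∀ t : ℝ, 0 ≤ t → c ≤ g x + t * g u + β * f x := fun t ht => by
    have := hℓT _ ⟨t, ht, rfl⟩
    rwa [hℓ, map_add, map_smul, smul_eq_mul] at this
  have hU' : ∀ (y : E) (a : ℝ), f y < a → g y + β * a < c := fun y a h => by
    have := hℓU (y, a) h
    rwa [hℓ] at this
  have hx0 := hT' 0 le_rfl
  rw [zero_mul, add_zero] at hx0
  have hβneg : β < 0 := by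
    have := hU' x (f x + 1) (by linarith)
    nlinarith
  have hle : ∀ y, g y + β * f y ≤ c := fun y => by
    refine le_of_forall_pos_le_add fun ε hε => ?_
    have hpos : 0 < ε / -β := div_pos hε (by linarith)
    have h1 := hU' y (f y + ε / -β) (by linarith)
    have h2 : β * (ε / -β) = -ε := by
      have := hβneg.ne
      field_simp
    nlinarith
  set s : E := (-β)⁻¹ • (InnerProductSpace.toDual ℝ E).symm g with hs
  have hsi : ∀ y, -β * ⟪s, y⟫ = g y := fun y => by
    rw [hs, real_inner_smul_left, InnerProductSpace.toDual_symm_apply, ← mul_assoc,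
      mul_inv_cancel₀ (by linarith : -β ≠ 0), one_mul]
  have hsS : s ∈ subdiff f x := fun y => by
    have h1 := hle y
    have h2 := hsi (y - x)
    rw [map_sub] at h2
    by_contra! hcon
    have := mul_lt_mul_of_pos_left hcon (by linarith : 0 < -β)
    rw [mul_add] at this
    linarith
  have hneg := hu s hsS
  have h1 : g u < 0 := by
    rw [← hsi u]
    exact mul_neg_of_pos_of_neg (by linarith) hneg
  have h2 := hle x
  have h3 := hT' 1 zero_le_one
  linarith

/-- The cone generated by a set. -/
def coneOf (S : Set E) : Set E := {v | ∃ τ : ℝ, 0 ≤ τ ∧ ∃ s ∈ S, τ • s = v}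

/-- Near a given `v` only bounded multipliers occur, since norms on `S` are bounded below; there the
cone is the image of a compact set. -/
theorem isClosed_coneOf {S : Set E} (hS : IsCompact S) (h0 : (0 : E) ∉ S) :
    IsClosed (coneOf S) := by
  rcases S.eq_empty_or_nonempty with rfl | hne
  · simp [coneOf]
  obtain ⟨r, hr, hrS⟩ : ∃ r : ℝ, 0 < r ∧ ∀ s ∈ S, r ≤ ‖s‖ := by
    obtain ⟨s, hs, hmin⟩ := hS.exists_isMinOn hne continuous_norm.continuousOn
    exact ⟨‖s‖, norm_pos_iff.2 fun h => h0 (h ▸ hs), fun t ht => hmin ht⟩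
  refine isClosed_of_closure_subset fun v hv => ?_
  set T := (‖v‖ + 1) / r with hT
  have hK : IsCompact ((fun p : ℝ × E => p.1 • p.2) '' (Set.Icc 0 T ×ˢ S)) :=
    (isCompact_Icc.prod hS).image (by fun_prop)
  have hmem : v ∈ closure ((fun p : ℝ × E => p.1 • p.2) '' (Set.Icc 0 T ×ˢ S)) := by
    rw [Metric.mem_closure_iff] at hv ⊢
    intro ε hε
    obtain ⟨w, ⟨τ, hτ, s, hs, rfl⟩, hd⟩ := hv (min ε 1) (lt_min hε one_pos)
    refine ⟨τ • s, ⟨(τ, s), ⟨⟨hτ, ?_⟩, hs⟩, rfl⟩, hd.trans_le (min_le_left _ _)⟩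
    rw [hT, le_div_iff₀ hr]
    have h1 : ‖τ • s‖ ≤ ‖v‖ + 1 := by
      have h2 : ‖τ • s‖ ≤ ‖v‖ + ‖v - τ • s‖ := by simpa using norm_sub_le v (v - τ • s)
      rw [← dist_eq_norm] at h2
      linarith [hd.trans_le (min_le_right ε 1)]
    rw [norm_smul, Real.norm_of_nonneg hτ] at h1
    exact (mul_le_mul_of_nonneg_left (hrS s hs) hτ).trans h1
  rw [hK.isClosed.closure_eq] at hmem
  obtain ⟨⟨τ, s⟩, ⟨hτ, hs⟩, rfl⟩ := hmem
  exact ⟨τ, hτ.1, s, hs, rfl⟩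

theorem convex_coneOf {S : Set E} (hc : Convex ℝ S) : Convex ℝ (coneOf S) := by
  rintro _ ⟨τ, hτ, s, hs, rfl⟩ _ ⟨σ, hσ, t, ht, rfl⟩ a b ha hb hab
  by_cases h0 : a * τ + b * σ = 0
  · have h1 : 0 ≤ a * τ := by positivity
    have h2 : 0 ≤ b * σ := by positivity
    refine ⟨0, le_rfl, s, hs, ?_⟩
    rw [smul_smul, smul_smul, show a * τ = 0 by linarith, show b * σ = 0 by linarith]
    simp
  · refine ⟨a * τ + b * σ, by positivity,
      (a * τ / (a * τ + b * σ)) • s + (b * σ / (a * τ + b * σ)) • t,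
      hc hs ht (by positivity) (by positivity) (by field_simp), ?_⟩
    rw [smul_add, smul_smul, smul_smul, smul_smul, smul_smul, mul_div_cancel₀ _ h0,
      mul_div_cancel₀ _ h0]

/-- The polar of the descent cone is contained in the cone generated by the subdifferential. -/
theorem ConvexOn.mem_coneOf_subdiff (hf : ConvexOn ℝ Set.univ f) (hc : Continuous f)
    (hne : (subdiff f x).Nonempty) (hcomp : IsCompact (subdiff f x)) (h0 : (0 : E) ∉ subdiff f x)
    {v : E} (hv : ∀ u ∈ descentCone f x, ⟪v, u⟫ ≤ 0) : v ∈ coneOf (subdiff f x) := by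
  set S := subdiff f x with hS
  have hKc := isClosed_coneOf hcomp h0
  have hKx : Convex ℝ (coneOf S) := convex_coneOf convex_subdiff
  obtain ⟨s₁, hs₁⟩ := hne
  have hKne : (coneOf S).Nonempty := ⟨(1 : ℝ) • s₁, 1, zero_le_one, s₁, hs₁, rfl⟩
  set p := proj (coneOf S) v with hp
  have hpK : p ∈ coneOf S := proj_mem hKc hKne v
  by_cases hvp : v - p = 0
  · rw [sub_eq_zero.1 hvp]; exact hpK
  exfalso
  set u := v - p with hu
  have hproj : ∀ z ∈ coneOf S, ⟪u, z - p⟫ ≤ 0 := fun z hz => inner_sub_proj_le hKc hKx hz v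
  obtain ⟨τ, hτ, s₀, hs₀, he⟩ := hpK
  have hup : ⟪u, p⟫ = 0 := by
    have h1 := hproj 0 ⟨0, le_rfl, s₁, hs₁, zero_smul _ _⟩
    have h2 := hproj ((2 * τ) • s₀) ⟨2 * τ, by positivity, s₀, hs₀, rfl⟩
    rw [mul_smul, he, two_smul, add_sub_cancel_right] at h2
    rw [zero_sub, inner_neg_right] at h1
    linarith
  have hus : ∀ s ∈ S, ⟪s, u⟫ ≤ 0 := fun s hs => by
    have h1 := hproj s ⟨1, zero_le_one, s, hs, one_smul _ _⟩
    rw [inner_sub_right, hup, sub_zero] at h1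
    rwa [real_inner_comm]
  have hvu : ⟪v, u⟫ = ‖u‖ ^ 2 := by
    rw [show v = u + p by rw [hu]; abel, inner_add_left, real_inner_self_eq_norm_sq,
      real_inner_comm, hup, add_zero]
  have hupos : 0 < ‖u‖ ^ 2 := by have := norm_pos_iff.2 hvp; positivity
  -- The residual `u` pairs nonpositively with `S`, but a descent direction needs strict negativity.
  -- The least-norm element `q` pairs positively with all of `S`, so `u - ε • q` is a descent
  -- direction for every `ε > 0`; letting `ε` be small contradicts `⟪v, u⟫ = ‖u‖ ^ 2 > 0`.
  set q := proj S 0 with hq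
  have hqS : q ∈ S := proj_mem hcomp.isClosed ⟨s₁, hs₁⟩ 0
  have hqpos : 0 < ‖q‖ ^ 2 := by
    have : 0 < ‖q‖ := norm_pos_iff.2 fun h => h0 (h ▸ hqS)
    positivity
  have hsq : ∀ s ∈ S, ‖q‖ ^ 2 ≤ ⟪s, q⟫ := fun s hs => by
    have h1 := inner_sub_proj_le hcomp.isClosed convex_subdiff hs 0
    rw [← hq, zero_sub, inner_neg_left, inner_sub_right, real_inner_self_eq_norm_sq,
      real_inner_comm] at h1
    linarith
  have hdesc : ∀ ε : ℝ, 0 < ε → ⟪v, u⟫ ≤ 0 + ε * ⟪v, q⟫ := fun ε hε => by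
    have h1 := hv (u - ε • q) (hf.mem_descentCone_of_inner_neg hc fun s hs => by
      rw [inner_sub_right, inner_smul_right]
      have h2 := mul_le_mul_of_nonneg_left (hsq s hs) hε.le
      have h3 : 0 < ε * ‖q‖ ^ 2 := by positivity
      linarith [hus s hs])
    rw [inner_sub_right, inner_smul_right] at h1
    linarith
  have h1 := hdesc (‖u‖ ^ 2 / (2 * (|⟪v, q⟫| + 1))) (by positivity)
  have h2 : ‖u‖ ^ 2 / (2 * (|⟪v, q⟫| + 1)) * ⟪v, q⟫ ≤ ‖u‖ ^ 2 / 2 := by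
    rw [div_mul_eq_mul_div, div_le_div_iff₀ (by positivity) (by norm_num)]
    nlinarith [le_abs_self ⟪v, q⟫]
  linarith

/-- In a cone the projection may be compared with both `0` and its own double. -/
theorem ConvexOn.inner_sub_proj_closure_descentCone (hf : ConvexOn ℝ Set.univ f) (g : E) :
    ⟪g - proj (closure (descentCone f x)) g, proj (closure (descentCone f x)) g⟫ = 0 := by
  set q := proj (closure (descentCone f x)) g with hq
  have hqD : q ∈ closure (descentCone f x) :=
    proj_mem isClosed_closure closure_descentCone_nonempty g
  have h1 := inner_sub_proj_le isClosed_closure hf.convex_closure_descentCone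
    (subset_closure zero_mem_descentCone : (0 : E) ∈ closure (descentCone f x)) g
  have h2 := inner_sub_proj_le isClosed_closure hf.convex_closure_descentCone
    (hf.add_mem_closure_descentCone hqD hqD) g
  rw [← hq, zero_sub, inner_neg_right] at h1
  rw [← hq, add_sub_cancel_right] at h2
  linarith

theorem ConvexOn.norm_proj_closure_descentCone_le (hf : ConvexOn ℝ Set.univ f) (g : E) :
    ‖proj (closure (descentCone f x)) g‖ ≤ ‖g‖ := by
  have h1 := hf.inner_sub_proj_closure_descentCone (x := x) g
  rw [inner_sub_left, real_inner_self_eq_norm_sq] at h1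
  have h2 := real_inner_le_norm g (proj (closure (descentCone f x)) g)
  by_contra! h
  nlinarith [norm_nonneg g]

/-- With `q` the projection and `s` a subgradient, `‖q‖ ^ 2 = ⟪g, q⟫ ≤ ⟪g - τ • s, q⟫`, and
Cauchy–Schwarz concludes. -/
theorem ConvexOn.norm_proj_le_infDist (hf : ConvexOn ℝ Set.univ f)
    (hne : (subdiff f x).Nonempty) (hcomp : IsCompact (subdiff f x)) {τ : ℝ} (hτ : 0 ≤ τ) (g : E) :
    ‖proj (closure (descentCone f x)) g‖ ≤ Metric.infDist g (τ • subdiff f x) := by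
  rw [infDist_eq_norm_sub_proj (hcomp.smul τ).isClosed hne.smul_set]
  obtain ⟨s, hs, he⟩ := exists_proj_smul_eq hcomp hne τ g
  rw [← he]
  have h1 := hf.inner_sub_proj_closure_descentCone (x := x) g
  set q := proj (closure (descentCone f x)) g with hq
  have hqD : q ∈ closure (descentCone f x) :=
    proj_mem isClosed_closure closure_descentCone_nonempty g
  have h2 := mul_nonpos_of_nonneg_of_nonpos hτ (inner_le_zero_of_mem_subdiff hs hqD)
  have h3 := real_inner_le_norm (g - τ • s) q
  rw [inner_sub_left, real_inner_self_eq_norm_sq] at h1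
  rw [inner_sub_left, real_inner_smul_left] at h3
  by_contra! h
  have h4 : 0 < ‖q‖ := (norm_nonneg _).trans_lt h
  nlinarith

/-- Moreau's decomposition: the residual `g - q` lies in the polar cone, hence is some `τ • s`, at
distance `‖q‖` from `g`. -/
theorem ConvexOn.exists_infDist_le_norm_proj (hf : ConvexOn ℝ Set.univ f) (hc : Continuous f)
    (hne : (subdiff f x).Nonempty) (hcomp : IsCompact (subdiff f x)) (h0 : (0 : E) ∉ subdiff f x)
    (g : E) : ∃ τ : ℝ, 0 ≤ τ ∧
      Metric.infDist g (τ • subdiff f x) ≤ ‖proj (closure (descentCone f x)) g‖ := by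
  set q := proj (closure (descentCone f x)) g with hq
  have hqD : q ∈ closure (descentCone f x) :=
    proj_mem isClosed_closure closure_descentCone_nonempty g
  obtain ⟨τ, hτ, s, hs, he⟩ := hf.mem_coneOf_subdiff hc hne hcomp h0 (v := g - q) fun u hu => by
    have := inner_sub_proj_le isClosed_closure hf.convex_closure_descentCone
      (hf.add_mem_closure_descentCone hqD (subset_closure hu)) g
    rwa [← hq, add_sub_cancel_left] at this
  refine ⟨τ, hτ, (Metric.infDist_le_dist_of_mem (Set.smul_mem_smul_set hs)).trans ?_⟩
  rw [he, dist_eq_norm, sub_sub_cancel]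

variable [MeasurableSpace E] [BorelSpace E]

theorem ConvexOn.statDim_descentCone_le (hf : ConvexOn ℝ Set.univ f)
    (hne : (subdiff f x).Nonempty) (hcomp : IsCompact (subdiff f x)) :
    statDim (descentCone f x) ≤ ⨅ τ : Set.Ici (0 : ℝ), expSqDist (subdiff f x) τ := by
  refine le_ciInf fun τ => integral_mono_of_nonneg
    (Filter.Eventually.of_forall fun _ => sq_nonneg _)
    (integrable_infDist_sq hcomp convex_subdiff hne τ.2)
    (Filter.Eventually.of_forall fun g => ?_)
  exact pow_le_pow_left₀ (norm_nonneg _) (hf.norm_proj_le_infDist hne hcomp τ.2 g) 2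

theorem ConvexOn.iInf_expSqDist_le_statDim (hf : ConvexOn ℝ Set.univ f) (hc : Continuous f)
    (hne : (subdiff f x).Nonempty) (hcomp : IsCompact (subdiff f x))
    (h0 : (0 : E) ∉ subdiff f x) :
    (⨅ τ : Set.Ici (0 : ℝ), expSqDist (subdiff f x) τ) ≤ statDim (descentCone f x) + 2 := by
  have hcont := continuous_proj isClosed_closure hf.convex_closure_descentCone
    (closure_descentCone_nonempty (f := f) (x := x))
  refine iInf_expSqDist_le hcomp convex_subdiff hne h0 (by fun_prop) (fun g => ?_) fun g => ?_
  · exact pow_le_pow_left₀ (norm_nonneg _) (hf.norm_proj_closure_descentCone_le g) 2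
  · obtain ⟨τ, hτ, h⟩ := hf.exists_infDist_le_norm_proj hc hne hcomp h0 g
    exact ⟨τ, hτ, pow_le_pow_left₀ Metric.infDist_nonneg h 2⟩

end DescentCone

/-! ### The weighted norm of the theorem and its error terms. -/

section Zeta

variable {n l : ℕ}

theorem norm21_add_le (X Y : RealMat n l) : norm21 (X + Y) ≤ norm21 X + norm21 Y := by
  rw [norm21, norm21, norm21, ← Finset.sum_add_distrib]
  exact Finset.sum_le_sum fun i _ => norm_add_le (X i) (Y i)

theorem norm21_smul (a : ℝ) (X : RealMat n l) : norm21 (a • X) = |a| * norm21 X := by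
  rw [norm21, norm21, Finset.mul_sum]
  exact Finset.sum_congr rfl fun i _ => norm_smul a (X i)

theorem continuous_norm21 : Continuous (norm21 : RealMat n l → ℝ) := by
  unfold norm21
  fun_prop

theorem convexOn_norm21 : ConvexOn ℝ Set.univ (norm21 : RealMat n l → ℝ) := by
  refine ⟨convex_univ, fun X _ Y _ a b ha hb _ => (norm21_add_le _ _).trans (le_of_eq ?_)⟩
  rw [norm21_smul, norm21_smul, abs_of_nonneg ha, abs_of_nonneg hb, smul_eq_mul, smul_eq_mul]

theorem norm21_pos {X : RealMat n l} (hX : X ≠ 0) : 0 < norm21 X := by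
  obtain ⟨i, hi⟩ : ∃ i, X i ≠ 0 := by
    by_contra! h
    exact hX (PiLp.ext h)
  exact Finset.sum_pos' (fun i _ => norm_nonneg _) ⟨i, Finset.mem_univ _, norm_pos_iff.2 hi⟩

variable {lam : ℝ} {W X : RealMat n l}

theorem continuous_zeta (lam : ℝ) (W : RealMat n l) : Continuous (zeta lam W) := by
  have := continuous_norm21 (n := n) (l := l)
  unfold zeta
  fun_prop

theorem convexOn_zeta (hlam : 0 ≤ lam) (W : RealMat n l) : ConvexOn ℝ Set.univ (zeta lam W) := by
  have h := (convexOn_norm21 (n := n) (l := l)).translate_right (-W)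
  simp only [Set.preimage_univ] at h
  have h2 := convexOn_norm21.add (h.smul hlam)
  refine h2.congr fun X _ => ?_
  simp [zeta, neg_add_eq_sub]

/-- The subgradient inequality is tested at the zero matrix, and the triangle inequality bounds the
term in `W`. -/
theorem mul_norm21_le_inner (hlam : 0 ≤ lam) {S : RealMat n l} (hS : S ∈ subdiff (zeta lam W) X) :
    (1 - lam) * norm21 X ≤ ⟪S, X⟫ := by
  have h1 := hS 0
  rw [zero_sub, inner_neg_right, zeta, zeta, zero_sub] at h1
  have h2 : norm21 (0 : RealMat n l) = 0 := by simp [norm21]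
  have h3 : norm21 (-W) ≤ norm21 (X - W) + norm21 X := by
    have h4 := norm21_add_le (X - W) (-X)
    have h5 : norm21 (-X) = norm21 X := by simp [norm21]
    rwa [show X - W + -X = -W by abel, h5] at h4
  have h6 := mul_le_mul_of_nonneg_left h3 hlam
  rw [h2] at h1
  linarith

/-- For weight at most `1` the triangle inequality makes the zero matrix a minimizer, where `0`
would be a subgradient. -/
theorem ne_zero_of_zero_notMem_subdiff (hlam : 0 ≤ lam) (hlam1 : lam ≤ 1)
    (h0 : (0 : RealMat n l) ∉ subdiff (zeta lam W) X) : X ≠ 0 := by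
  rintro rfl
  refine h0 fun Y => ?_
  have h2 : norm21 (0 : RealMat n l) = 0 := by simp [norm21]
  have h3 : norm21 (0 - W) ≤ norm21 (Y - W) + norm21 Y := by
    have h4 := norm21_add_le (Y - W) (-Y)
    have h5 : norm21 (-Y) = norm21 Y := by simp [norm21]
    rwa [show Y - W + -Y = 0 - W by abel, h5] at h4
  have h6 := mul_le_mul_of_nonneg_left h3 hlam
  have h7 : 0 ≤ norm21 Y := Finset.sum_nonneg fun i _ => norm_nonneg _
  rw [inner_zero_left, add_zero, zeta, zeta, h2]
  nlinarith

theorem minPairing_pos (hlam : 0 ≤ lam) (hlam1 : lam < 1)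
    (hne : (subdiff (zeta lam W) X).Nonempty)
    (h0 : (0 : RealMat n l) ∉ subdiff (zeta lam W) X) : 0 < minPairing lam W X := by
  have hX := norm21_pos (ne_zero_of_zero_notMem_subdiff hlam hlam1.le h0)
  refine (mul_pos (sub_pos.2 hlam1) hX).trans_le (le_csInf (hne.image _) ?_)
  rintro _ ⟨S, hS, rfl⟩
  exact mul_norm21_le_inner hlam hS

/-- By Cauchy–Schwarz the smallest pairing is at most `‖S‖ * ‖X‖` for any subgradient `S`, so the
quotient without its factor `2` is at least `1`. -/
theorem two_le_xi (hne : (subdiff (zeta lam W) X).Nonempty)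
    (hcomp : IsCompact (subdiff (zeta lam W) X)) (hm : 0 < minPairing lam W X) :
    2 ≤ xi lam W X := by
  obtain ⟨S, hS⟩ := hne
  have h1 : minPairing lam W X ≤ ⟪S, X⟫ :=
    csInf_le (hcomp.image (f := fun S => ⟪S, X⟫) (by fun_prop)).bddBelow ⟨S, hS, rfl⟩
  have h2 : ‖S‖ ≤ sSup ((fun S => ‖S‖) '' subdiff (zeta lam W) X) :=
    le_csSup (hcomp.image continuous_norm).bddAbove ⟨S, hS, rfl⟩
  have h3 := real_inner_le_norm S X
  rw [xi, le_div_iff₀ hm]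
  nlinarith [mul_le_mul_of_nonneg_left h2 (norm_nonneg X)]

theorem IsJointSparse.pos_and_le {k : ℕ} (hk : IsJointSparse k X) (hX : X ≠ 0) :
    0 < k ∧ k ≤ n := by
  obtain ⟨i, hi⟩ : ∃ i, X i ≠ 0 := by
    by_contra! h
    exact hX (PiLp.ext h)
  rw [IsJointSparse] at hk
  subst hk
  refine ⟨(Set.ncard_pos (Set.toFinite _)).2 ⟨i, hi⟩, ?_⟩
  have := Set.ncard_le_card {i | X i ≠ 0}
  simpa using this

end Zeta

theorem mainTheorem2 (n l : ℕ) (lam : ℝ) (hlam : 0 ≤ lam) (W X : RealMat n l)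
    (hne : (subdiff (zeta lam W) X).Nonempty)
    (hcompact : IsCompact (subdiff (zeta lam W) X))
    (hzero : (0 : RealMat n l) ∉ subdiff (zeta lam W) X) :
    statDim (descentCone (zeta lam W) X)
        ≤ ⨅ τ : Set.Ici (0 : ℝ), expSqDist (subdiff (zeta lam W) X) τ ∧
    (0 < minPairing lam W X →
      (⨅ τ : Set.Ici (0 : ℝ), expSqDist (subdiff (zeta lam W) X) τ) - xi lam W X
        ≤ statDim (descentCone (zeta lam W) X)) ∧
    (lam < 1 → 0 < minPairing lam W X) ∧
    (lam < 1 → ∀ k : ℕ, IsJointSparse k X →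
      (⨅ τ : Set.Ici (0 : ℝ), expSqDist (subdiff (zeta lam W) X) τ)
          - 2 * (1 + lam) * √(n : ℝ) / ((1 - lam) * √(k : ℝ))
        ≤ statDim (descentCone (zeta lam W) X)) := by
  have hgap := (convexOn_zeta hlam W).iInf_expSqDist_le_statDim (continuous_zeta lam W) hne
    hcompact hzero
  refine ⟨(convexOn_zeta hlam W).statDim_descentCone_le hne hcompact, fun hm => ?_,
    fun hlam1 => minPairing_pos hlam hlam1 hne hzero, fun hlam1 k hk => ?_⟩
  · have := two_le_xi hne hcompact hm
    linarith
  · obtain ⟨hk0, hkn⟩ := hk.pos_and_le (ne_zero_of_zero_notMem_subdiff hlam hlam1.le hzero)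
    have hk' : 0 < √(k : ℝ) := Real.sqrt_pos.2 (by exact_mod_cast hk0)
    have hkn' : √(k : ℝ) ≤ √(n : ℝ) := Real.sqrt_le_sqrt (by exact_mod_cast hkn)
    -- This error also dominates the universal gap `2`, because `k ≤ n` and `1 - lam ≤ 1 + lam`.
    have : 2 ≤ 2 * (1 + lam) * √(n : ℝ) / ((1 - lam) * √(k : ℝ)) := by
      rw [le_div_iff₀ (mul_pos (sub_pos.2 hlam1) hk')]
      nlinarith [mul_nonneg hlam hk'.le, mul_nonneg hlam (hk'.le.trans hkn')]
    linarith
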